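/- Let $\ell>0$. For smooth $2\pi$-periodic functions $L_\pm$ on $\mathbb R$, the Bañados metric $g[L_+,L_-]$ in coordinates $(r,x^+,x^-)$, $(x^+,x^-)\sim(x^++2\pi,x^--2\pi)$, is $$ds^2=\ell^2\frac{dr^2}{r^2}-\Big(r\,dx^+-\frac{\ell^2L_-(x^-)\,dx^-}{r}\Big)\Big(r\,dx^--\frac{\ell^2L_+(x^+)\,dx^+}{r}\Big).$$ Let $h_\pm:\mathbb R\to\mathbb R$ be smooth with $h_\pm'>0$ and $h_\pm(x+2\pi)=h_\pm(x)+2\pi$. Call a map $\Phi:(r,x^+,x^-)\mapsto(R,X^+,X^-)$ a finite Fefferman–Graham-preserving diffeomorphism with boundary maps $h_\pm$ if, for some $\rho\ge 0$: $\Phi$ is a smooth diffeomorphism of $\{r>\rho\}$ (on the universal cover) onto its image in the patch $\{R>0,\ R^4>\ell^4L_+(X^+)L_-(X^-)\}$; $\Phi$ commutes with the identification; the pulled-back metric $\tilde g=\Phi^*g[L_+,L_-]$ satisfies $\tilde g_{rr}=\ell^2/r^2$, $\tilde g_{r\pm}=0$; and, as $r\to\infty$ at each fixed $(x^+,x^-)$,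 $X^\pm\to h_\pm(x^\pm)$ and $R/r\to 1/\sqrt{h_+'(x^+)\,h_-'(x^-)}$. Then: 1. For all such $L_\pm$, $h_\pm$ a diffeomorphism of this kind exists, and it can be chosen so that its image contains $\{R>\rho'\}$ for some $\rho'$. 2. Every diffeomorphism of this kind satisfies, as $r\to\infty$ at each fixed $(x^+,x^-)$, $$X^\pm=h_\pm+\frac{\ell^2}{2r^2}\frac{h_\mp''}{h_\mp'}\,h_\pm'+O(r^{-4}),\qquad R=\frac{r}{\sqrt{h_+'h_-'}}+O(r^{-1}),$$ and maps the Bañados metric to a Bañados metric: on all of $\{r>\rho\}$, $\Phi^*g[L_+,L_-]=g[\tilde L_+,\tilde L_-]$, where $$\tilde L_\pm(x^\pm)=h_\pm'(x^\pm)^2\,L_\pm\big(h_\pm(x^\pm)\big)-\tfrac12 S[h_\pm;x^\pm],\qquad S[h;x]=\frac{h'''}{h'}-\frac{3h''^2}{2h'^2},$$ and $\tilde L_\pm$ are again smooth and $2\pi$-periodic. 3. If $h_\pm'=e^{\Psi_\pm}$ with $\Psi_\pm$ real-valued, then $\Psi_\pm$ are smooth and $2\pi$-periodic and $\tilde L_\pm=e^{2\Psi_\pm}\,L_\pm\circ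 h_\pm+\tfrac14\Psi_\pm'^2-\tfrac12\Psi_\pm''$. -/

import Mathlib

open Filter Set Topology Asymptotics
open scoped ContDiff

/-- Coordinates `(r, x⁺, x⁻)`; tangent vectors are written in the same way, as
`(v^r, v^+, v^-)`. The angular identification is imposed through `deck` below. -/
abbrev Coord : Type := ℝ × ℝ × ℝ

/-- A field of covariant two-tensors in coordinates: `g p v w` is `g_{μν}(p) v^μ w^ν`. -/
abbrev TensorField : Type := Coord → Coord → Coord → ℝ

/-- Admissible functions `L_±` of a Bañados metric: smooth and single-valued on the circle. -/
structure IsBanadosFunction (L : ℝ → ℝ) : Prop where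
  smooth : ContDiff ℝ ∞ L
  periodic : Function.Periodic L (2 * Real.pi)

/-- The Bañados metric
`ℓ² dr²/r² - (r dx⁺ - ℓ² L₋(x⁻) dx⁻ / r) (r dx⁻ - ℓ² L₊(x⁺) dx⁺ / r)`,
the product of one-forms being the symmetric product `α β = (α ⊗ β + β ⊗ α) / 2`. -/
noncomputable def banadosMetric (ℓ : ℝ) (Lp Lm : ℝ → ℝ) : TensorField :=
  fun p v w =>
    let r := p.1
    let α : Coord → ℝ := fun u => r * u.2.1 - ℓ ^ 2 * Lm p.2.2 * u.2.2 / r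
    let β : Coord → ℝ := fun u => r * u.2.2 - ℓ ^ 2 * Lp p.2.1 * u.2.1 / r
    ℓ ^ 2 * v.1 * w.1 / r ^ 2 - (α v * β w + α w * β v) / 2

/-- The coordinate patch of the Bañados metric that reaches the boundary `r = ∞`: the metric is
nondegenerate exactly where `r⁴ ≠ ℓ⁴ L₊ L₋`. -/
def banadosPatch (ℓ : ℝ) (Lp Lm : ℝ → ℝ) : Set Coord :=
  {p | 0 < p.1 ∧ ℓ ^ 4 * Lp p.2.1 * Lm p.2.2 < p.1 ^ 4}

/-- The neighbourhood `r > ρ` of the boundary. -/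
def nearBoundary (ρ : ℝ) : Set Coord := {p | ρ < p.1}

/-- The identification `(x⁺, x⁻) ∼ (x⁺ + 2π, x⁻ - 2π)`. -/
noncomputable def deck (p : Coord) : Coord :=
  (p.1, p.2.1 + 2 * Real.pi, p.2.2 - 2 * Real.pi)

/-- Pull-back: `(Φ^* g)_{μν}(x) = g_{αβ}(X) ∂_μ X^α ∂_ν X^β` with `X = Φ x`. -/
noncomputable def pullbackTensor (Φ : Coord → Coord) (g : TensorField) : TensorField :=
  fun p v w => g (Φ p) (fderiv ℝ Φ p v) (fderiv ℝ Φ p w)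

/-- The Fefferman–Graham gauge `g_{rr} = ℓ²/r²`, `g_{r+} = g_{r-} = 0` on `U`. -/
def IsFeffermanGrahamOn (ℓ : ℝ) (U : Set Coord) (g : TensorField) : Prop :=
  ∀ p ∈ U, g p (1, 0, 0) (1, 0, 0) = ℓ ^ 2 / p.1 ^ 2 ∧
    g p (1, 0, 0) (0, 1, 0) = 0 ∧ g p (1, 0, 0) (0, 0, 1) = 0

/-- Boundary maps: smooth, increasing and quasi-periodic. -/
structure IsBoundaryMap (h : ℝ → ℝ) : Prop where
  smooth : ContDiff ℝ ∞ h
  deriv_pos : ∀ x, 0 < deriv h x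
  quasiperiodic : ∀ x, h (x + 2 * Real.pi) = h x + 2 * Real.pi

/-- `Φ = (R, X⁺, X⁻)` is a diffeomorphism from `r > ρ` onto its image in the patch of the Bañados
metric with functions `Lp`, `Lm`. It respects the identification, the pulled-back metric is again
in Fefferman–Graham gauge, and at leading order `X^± → h_±(x^±)`, `R ∼ r / √(h₊' h₋')`. -/
structure IsFGDiffeo (ℓ : ℝ) (Lp Lm hp hm : ℝ → ℝ) (ρ : ℝ) (Φ : Coord → Coord) : Prop where
  smooth : ContDiffOn ℝ ∞ Φ (nearBoundary ρ)
  injOn : InjOn Φ (nearBoundary ρ)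
  bijective_fderiv : ∀ p ∈ nearBoundary ρ, Function.Bijective (fderiv ℝ Φ p)
  mapsTo : MapsTo Φ (nearBoundary ρ) (banadosPatch ℓ Lp Lm)
  deck_comm : ∀ p ∈ nearBoundary ρ, Φ (deck p) = deck (Φ p)
  gauge : IsFeffermanGrahamOn ℓ (nearBoundary ρ) (pullbackTensor Φ (banadosMetric ℓ Lp Lm))
  tendsto_plus : ∀ a b : ℝ, Tendsto (fun r : ℝ => (Φ (r, a, b)).2.1) atTop (𝓝 (hp a))
  tendsto_minus : ∀ a b : ℝ, Tendsto (fun r : ℝ => (Φ (r, a, b)).2.2) atTop (𝓝 (hm b))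
  tendsto_radial : ∀ a b : ℝ, Tendsto (fun r : ℝ => (Φ (r, a, b)).1 / r) atTop
    (𝓝 (1 / √(deriv hp a * deriv hm b)))

/-- The Schwarzian derivative `S[h; x] = h'''/h' - 3 h''² / (2 h'²)`. -/
noncomputable def schwarzian (h : ℝ → ℝ) (x : ℝ) : ℝ :=
  iteratedDeriv 3 h x / deriv h x - 3 * iteratedDeriv 2 h x ^ 2 / (2 * deriv h x ^ 2)

/-- The transformed function `L̃(x) = h'(x)² L(h(x)) - S[h; x] / 2`. -/
noncomputable def transformedL (L h : ℝ → ℝ) (x : ℝ) : ℝ :=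
  deriv h x ^ 2 * L (h x) - 1 / 2 * schwarzian h x

/-! ### Hill's equation -/

/-! Let `ψ±` be a vector of two solutions of Hill's equation `u'' = L± u` with Wronskian `1`. The
map `y = r ψ₊ ψ₋ᵀ - (ℓ²/r) ψ₊' ψ₋'ᵀ` sends the coordinates into the quadric `det = -ℓ²` of `2 × 2`
matrices, and the Bañados metric is the one induced by the polarized determinant
(`banadosMetric_eq_polar`). All questions about `Φ` become questions about `y ∘ Φ`.

Rigidity. In Fefferman–Graham gauge the vector `∂ᵣ²(y ∘ Φ) - (y ∘ Φ)/r² + ∂ᵣ(y ∘ Φ)/r` is orthogonal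
to the position and to every tangent vector, hence zero, so `y ∘ Φ = r A + B/r` along radial curves.
The boundary conditions give `A = χ₊ χ₋ᵀ` with `χ = (ψ ∘ h)/√h'`. The determinant and the conditions
`g_{r±} = 0` then leave only `B = -ℓ² χ₊' χ₋'ᵀ`. Since `χ` solves Hill's equation with potential
`h'² L ∘ h - S[h]/2` (`hasDerivAt_deriv_hillTransform`), `y ∘ Φ` is the embedding of the transformed
Bañados geometry (`hillEmbedding_comp`), and the pulled-back metric follows.

Expansion. Equality of two embedded points amounts to two scalar equations for `(X⁺, X⁻)`, smooth in
`t = 1/r²`, and a formula for `R/r` (`hillEmbedding_eq_iff`). At `t = 0` the solution is `X± = h±`;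
expanding to first order in `t` gives the stated asymptotics.

Existence. The same equations are solved by the implicit function theorem at `t = 0`, uniformly over
the boundary: `ψ` and `χ` have equal monodromy, so the system is invariant under translations by
`2πℤ²` and a compact cell suffices (`exists_implicit_of_equivariant`). The system with the frames
exchanged, based on `h±⁻¹`, yields injectivity and a full neighbourhood of infinity in the image. -/

theorem exists_local_hill_solution {L : ℝ → ℝ} (hL : Continuous L) {K : NNReal}
    (hK : ∀ x, |L x| ≤ K) (t₀ : ℝ) (x₀ : ℝ × ℝ) :
    ∃ α : ℝ → ℝ × ℝ, α t₀ = x₀ ∧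
      ∀ t ∈ Ioo (t₀ - 1 / (2 * (K + 1))) (t₀ + 1 / (2 * (K + 1))),
        HasDerivAt α ((α t).2, L t * (α t).1) t := by
  set ε : ℝ := 1 / (2 * (K + 1)) with hε
  have hK0 : (0 : ℝ) ≤ K := K.2
  have hε0 : 0 < ε := by positivity
  have hb : ∀ t (z : ℝ × ℝ), ‖((z.2, L t * z.1) : ℝ × ℝ)‖ ≤ (K + 1) * ‖z‖ := by
    intro t z
    rw [Prod.norm_def]
    refine max_le ?_ ?_
    · calc ‖z.2‖ ≤ 1 * ‖z‖ := by rw [one_mul]; exact norm_snd_le z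
        _ ≤ (K + 1) * ‖z‖ := by gcongr; linarith
    · calc ‖L t * z.1‖ = |L t| * ‖z.1‖ := by rw [norm_mul, Real.norm_eq_abs]
        _ ≤ (K + 1) * ‖z‖ := by
          gcongr
          · linarith [hK t]
          · exact norm_fst_le z
  -- On the ball of radius `‖x₀‖ + 1` the speed is at most `(K + 1)(2‖x₀‖ + 1)`, so within time `1 /
  -- (2(K + 1))` the displacement is at most `‖x₀‖ + 1/2`. By linearity this time depends neither on
  -- `t₀` nor on `x₀`, which is what global continuation needs.
  have hPL : IsPicardLindelof (fun t (z : ℝ × ℝ) => (z.2, L t * z.1))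
      (tmin := t₀ - ε) (tmax := t₀ + ε) ⟨t₀, by constructor <;> linarith⟩ x₀
      (‖x₀‖₊ + 1) 0 ((K + 1) * (2 * ‖x₀‖₊ + 1)) (K + 1) := by
    refine ⟨fun t _ => ?_, fun z _ => ?_, fun t _ z hz => ?_, ?_⟩
    · refine LipschitzWith.lipschitzOnWith (LipschitzWith.of_dist_le_mul fun z w => ?_)
      rw [dist_eq_norm, dist_eq_norm]
      have := hb t (z - w)
      simpa [mul_sub] using this
    · fun_prop
    · refine (hb t z).trans ?_
      push_cast
      gcongr
      have h1 : ‖z - x₀‖ ≤ ‖x₀‖ + 1 := by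
        have := mem_closedBall_iff_norm.1 hz
        simpa using this
      have h2 := norm_le_norm_add_norm_sub' z x₀
      linarith
    · have : max (t₀ + ε - t₀) (t₀ - (t₀ - ε)) = ε := by simp
      push_cast
      rw [this, hε]
      have h0 := norm_nonneg x₀
      have : ((K : ℝ) + 1) * (2 * ‖x₀‖ + 1) * (1 / (2 * (K + 1))) = ‖x₀‖ + 1 / 2 := by
        field_simp
      linarith
  obtain ⟨α, h0, hα⟩ := hPL.exists_eq_forall_mem_Icc_hasDerivWithinAt₀
  refine ⟨α, h0, fun t ht => ?_⟩
  exact (hα t (Ioo_subset_Icc_self ht)).hasDerivAt (Icc_mem_nhds ht.1 ht.2)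

-- Adding time as a coordinate makes the system autonomous. A vector field whose integral curves all
-- exist for one common time has global integral curves.
open scoped Manifold in
theorem exists_hill_solution {L : ℝ → ℝ} (hL : ContDiff ℝ ∞ L) {K : NNReal}
    (hK : ∀ x, |L x| ≤ K) (x₀ : ℝ × ℝ) :
    ∃ α : ℝ → ℝ × ℝ, α 0 = x₀ ∧ ∀ t, HasDerivAt α ((α t).2, L t * (α t).1) t := by
  let v : ℝ × ℝ × ℝ → ℝ × ℝ × ℝ := fun z => (1, z.2.2, L z.1 * z.2.1)
  have hv : ContDiff ℝ 1 v := by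
    have := hL.of_le (m := 1) (by exact_mod_cast le_top)
    fun_prop
  have hε : (0 : ℝ) < 1 / (2 * (K + 1)) := by have := K.2; positivity
  have key := exists_isMIntegralCurve_of_isMIntegralCurveOn (M := ℝ × ℝ × ℝ)
    (I := 𝓘(ℝ, ℝ × ℝ × ℝ)) (v := v)
    (contMDiff_vectorSpace_iff_contDiff.2 hv) hε (fun z => by
      obtain ⟨α, h0, hα⟩ := exists_local_hill_solution hL.continuous hK z.1 z.2
      refine ⟨fun s => (z.1 + s, α (z.1 + s)), by simp [h0], ?_⟩
      intro t ht
      have h1 := hα (z.1 + t) ⟨by linarith [ht.1], by linarith [ht.2]⟩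
      have h2 : HasDerivAt (fun s => z.1 + s) 1 t := (hasDerivAt_id t).const_add z.1
      have h3 := h2.prodMk (h1.scomp t h2)
      rw [one_smul] at h3
      have h4 := h3.hasFDerivAt.hasFDerivWithinAt 
        (s := Ioo (-(1 / (2 * ((K : ℝ) + 1)))) (1 / (2 * (K + 1))))
      have e : ContinuousLinearMap.toSpanSingleton ℝ (v (z.1 + t, α (z.1 + t))) =
          (1 : ℝ →L[ℝ] ℝ).smulRight (v (z.1 + t, α (z.1 + t))) := by ext <;> simp
      exact e ▸ h4.hasMFDerivWithinAt) ((0 : ℝ), x₀)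
  obtain ⟨γ, h0, hγ⟩ := key
  have h1 : ∀ t, HasDerivAt γ (v (γ t)) t := fun t => by
    have h2 : HasFDerivAt γ ((1 : ℝ →L[ℝ] ℝ).smulRight (v (γ t))) t := (hγ t).hasFDerivAt
    simpa using h2.hasDerivAt
  have hf : ∀ t, (γ t).1 = t := by
    have hd : ∀ t, HasDerivAt (fun t => (γ t).1 - t) 0 t := fun t => by
      have := ((hasFDerivAt_fst (𝕜 := ℝ) (p := γ t)).comp_hasDerivAt t (h1 t)).sub (hasDerivAt_id t)
      simpa [v] using! this
    intro t
    have := is_const_of_deriv_eq_zero (fun t => (hd t).differentiableAt)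
      (fun t => (hd t).deriv) t 0
    simp only [h0, sub_zero] at this
    linarith
  refine ⟨fun t => (γ t).2, by simp [h0], fun t => ?_⟩
  have := (hasFDerivAt_snd (𝕜 := ℝ) (p := γ t)).comp_hasDerivAt t (h1 t)
  simpa [v, hf t] using! this

/-- A pair of solutions of Hill's equation `y'' = L y` with Wronskian `1`. -/
structure IsHillBasis (L c s : ℝ → ℝ) : Prop where
  smooth_fst : ContDiff ℝ ∞ c
  smooth_snd : ContDiff ℝ ∞ s
  hill_fst : ∀ x, HasDerivAt (deriv c) (L x * c x) x
  hill_snd : ∀ x, HasDerivAt (deriv s) (L x * s x) x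
  wronskian : ∀ x, c x * deriv s x - deriv c x * s x = 1

/-- Bootstrapping: the equation expresses the derivatives of `u` and `u'` through `u'` and `L u`, so
both functions gain one order of smoothness together. -/
theorem contDiff_of_hill {L u u' : ℝ → ℝ} (hL : ContDiff ℝ ∞ L)
    (hu : ∀ x, HasDerivAt u (u' x) x) (hu' : ∀ x, HasDerivAt u' (L x * u x) x) :
    ContDiff ℝ ∞ u := by
  have key : ∀ n : ℕ, ContDiff ℝ n u ∧ ContDiff ℝ n u' := by
    intro n
    induction n with
    | zero =>
      have h1 : Continuous u := continuous_iff_continuousAt.2 fun x => (hu x).continuousAt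
      have h2 : Continuous u' := continuous_iff_continuousAt.2 fun x => (hu' x).continuousAt
      exact ⟨contDiff_zero.2 h1, contDiff_zero.2 h2⟩
    | succ n ih =>
      have hLn : ContDiff ℝ n L := hL.of_le (by exact_mod_cast le_top)
      have e1 : deriv u = u' := funext fun x => (hu x).deriv
      have e2 : deriv u' = fun x => L x * u x := funext fun x => (hu' x).deriv
      push_cast
      refine ⟨contDiff_succ_iff_deriv.2 ⟨fun x => (hu x).differentiableAt, by simp, ?_⟩,
        contDiff_succ_iff_deriv.2 ⟨fun x => (hu' x).differentiableAt, by simp, ?_⟩⟩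
      · rw [e1]; exact ih.2
      · rw [e2]; exact hLn.mul ih.1
  exact contDiff_infty.2 fun n => (key n).1

theorem IsBanadosFunction.exists_bound {L : ℝ → ℝ} (hL : IsBanadosFunction L) :
    ∃ K : NNReal, ∀ x, |L x| ≤ K := by
  have hcpt := isCompact_Icc (a := (0 : ℝ)) (b := 2 * Real.pi)
  obtain ⟨C, hC⟩ := hcpt.exists_bound_of_continuousOn hL.smooth.continuous.continuousOn
  refine ⟨C.toNNReal, fun x => ?_⟩
  obtain ⟨y, hy, hxy⟩ := hL.periodic.exists_mem_Ico₀ (by positivity) x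
  rw [hxy]
  exact (hC y (Ico_subset_Icc_self hy)).trans (Real.le_coe_toNNReal C)

theorem IsBanadosFunction.exists_isHillBasis {L : ℝ → ℝ} (hL : IsBanadosFunction L) :
    ∃ c s : ℝ → ℝ, IsHillBasis L c s := by
  obtain ⟨K, hK⟩ := hL.exists_bound
  obtain ⟨α, hα0, hα⟩ := exists_hill_solution hL.smooth hK (1, 0)
  obtain ⟨β, hβ0, hβ⟩ := exists_hill_solution hL.smooth hK (0, 1)
  have h1 : ∀ γ : ℝ → ℝ × ℝ, (∀ t, HasDerivAt γ ((γ t).2, L t * (γ t).1) t) →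
      (∀ t, HasDerivAt (fun t => (γ t).1) (γ t).2 t) ∧
      (∀ t, HasDerivAt (fun t => (γ t).2) (L t * (γ t).1) t) := fun γ hγ =>
    ⟨fun t => by simpa using! (hasFDerivAt_fst (𝕜 := ℝ) (p := γ t)).comp_hasDerivAt t (hγ t),
     fun t => by simpa using! (hasFDerivAt_snd (𝕜 := ℝ) (p := γ t)).comp_hasDerivAt t (hγ t)⟩
  obtain ⟨a1, a2⟩ := h1 α hα
  obtain ⟨b1, b2⟩ := h1 β hβ
  have ea : deriv (fun t => (α t).1) = fun t => (α t).2 := funext fun x => (a1 x).deriv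
  have eb : deriv (fun t => (β t).1) = fun t => (β t).2 := funext fun x => (b1 x).deriv
  refine ⟨fun t => (α t).1, fun t => (β t).1, contDiff_of_hill hL.smooth a1 a2,
    contDiff_of_hill hL.smooth b1 b2, by rw [ea]; exact a2, by rw [eb]; exact b2, ?_⟩
  rw [ea, eb]
  have hd : ∀ t, HasDerivAt (fun t => (α t).1 * (β t).2 - (α t).2 * (β t).1) 0 t := fun t => by
    refine (((a1 t).mul (b2 t)).sub ((a2 t).mul (b1 t))).congr_deriv ?_
    ring
  intro x
  have := is_const_of_deriv_eq_zero (fun t => (hd t).differentiableAt) (fun t => (hd t).deriv) x 0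
  simpa [hα0, hβ0] using this

/-! ### A uniform implicit function theorem for periodic data -/

/-- The translation of `(t, x⁺, x⁻)` by a lattice vector. -/
noncomputable def latticeShift (n m : ℤ) : Coord := (0, n * (2 * Real.pi), m * (2 * Real.pi))

theorem exists_latticeShift (p : Coord) : ∃ (n m : ℤ) (q : Coord), p = q + latticeShift n m ∧
    q.1 = p.1 ∧ q.2.1 ∈ Icc 0 (2 * Real.pi) ∧ q.2.2 ∈ Icc 0 (2 * Real.pi) := by
  have hπ := Real.two_pi_pos
  refine ⟨toIcoDiv hπ 0 p.2.1, toIcoDiv hπ 0 p.2.2,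
    (p.1, toIcoMod hπ 0 p.2.1, toIcoMod hπ 0 p.2.2), ?_, rfl, ?_, ?_⟩
  · have h1 := toIcoMod_add_toIcoDiv_zsmul hπ 0 p.2.1
    have h2 := toIcoMod_add_toIcoDiv_zsmul hπ 0 p.2.2
    rw [zsmul_eq_mul] at h1 h2
    ext
    · simp [latticeShift]
    · simp [latticeShift, h1]
    · simp [latticeShift, h2]
  · have := toIcoMod_mem_Ico hπ 0 p.2.1
    rw [zero_add] at this
    exact Ico_subset_Icc_self this
  · have := toIcoMod_mem_Ico hπ 0 p.2.2
    rw [zero_add] at this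
    exact Ico_subset_Icc_self this

/-- The compact fundamental cell of the boundary `t = 0`. -/
def boundaryCell : Set Coord := {0} ×ˢ Icc 0 (2 * Real.pi) ×ˢ Icc 0 (2 * Real.pi)

theorem isCompact_boundaryCell : IsCompact boundaryCell :=
  isCompact_singleton.prod (isCompact_Icc.prod isCompact_Icc)

theorem dist_boundary (p : Coord) : dist p (0, p.2) = |p.1| := by
  simp [Prod.dist_eq]

/-- Near the boundary cell and near the graph of `H`, an open set containing the part of the graph
over the cell contains a uniform neighbourhood of it. -/
theorem exists_uniform_of_isOpen {U : Set (Coord × ℝ × ℝ)} (hU : IsOpen U) {H : Coord → ℝ × ℝ}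
    (hH : Continuous H) (hHt : ∀ p, H (0, p.2) = H p) (hK : ∀ p ∈ boundaryCell, (p, H p) ∈ U) :
    ∃ ε > 0, ∀ (p : Coord) (z : ℝ × ℝ), |p.1| < ε → p.2.1 ∈ Icc 0 (2 * Real.pi) →
      p.2.2 ∈ Icc 0 (2 * Real.pi) → dist z (H p) < ε → (p, z) ∈ U := by
  have hc : IsCompact ((fun p => (p, H p)) '' boundaryCell) :=
    isCompact_boundaryCell.image (by fun_prop)
  obtain ⟨ε, hε, h⟩ := hc.exists_thickening_subset_open hU (by rintro _ ⟨p, hp, rfl⟩; exact hK p hp)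
  refine ⟨ε, hε, fun p z h1 h2 h3 h4 => h ?_⟩
  rw [Metric.mem_thickening_iff]
  refine ⟨((0, p.2), H (0, p.2)), ⟨(0, p.2), ⟨rfl, h2, h3⟩, rfl⟩, ?_⟩
  rw [Prod.dist_eq, max_lt_iff, dist_boundary, hHt]
  exact ⟨h1, h4⟩

/-- The same for an open set that is invariant under lattice translations. -/
theorem exists_uniform_of_isOpen_of_shift {U : Set (Coord × ℝ × ℝ)} (hU : IsOpen U)
    {H : Coord → ℝ × ℝ} (hH : Continuous H) (hHt : ∀ p, H (0, p.2) = H p)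
    (hK : ∀ p ∈ boundaryCell, (p, H p) ∈ U)
    (hUs : ∀ n m p z, (p, z) ∈ U → (p + latticeShift n m, z + (latticeShift n m).2) ∈ U)
    (hHs : ∀ n m p, H (p + latticeShift n m) = H p + (latticeShift n m).2) :
    ∃ ε > 0, ∀ (p : Coord) (z : ℝ × ℝ), |p.1| < ε → dist z (H p) < ε → (p, z) ∈ U := by
  obtain ⟨ε, hε, h⟩ := exists_uniform_of_isOpen hU hH hHt hK
  refine ⟨ε, hε, fun p z h1 h2 => ?_⟩
  obtain ⟨n, m, q, rfl, hq, hq1, hq2⟩ := exists_latticeShift p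
  obtain ⟨z, rfl⟩ : ∃ z', z = z' + (latticeShift n m).2 := ⟨z - _, (sub_add_cancel _ _).symm⟩
  rw [hHs, dist_add_right] at h2
  rw [← hq] at h1
  exact hUs n m q z (h q z h1 hq1 hq2 h2)

theorem exists_equiv_of_injective {V : Type*} [NormedAddCommGroup V] [NormedSpace ℝ V]
    [FiniteDimensional ℝ V] (f : V →L[ℝ] V) (hf : ∀ v, f v = 0 → v = 0) :
    ∃ e : V ≃L[ℝ] V, (e : V →L[ℝ] V) = f := by
  have hinj : Function.Injective (f : V →ₗ[ℝ] V) := (injective_iff_map_eq_zero _).2 hf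
  refine ⟨(LinearEquiv.ofInjectiveEndo (f : V →ₗ[ℝ] V) hinj).toContinuousLinearEquiv, ?_⟩
  ext v
  rfl

/-! ### Inverse functions near the boundary graph -/

section

variable {E : Coord × ℝ × ℝ → ℝ × ℝ} {H : Coord → ℝ × ℝ}

theorem hasFDerivAt_prodMk_fst (hE : ContDiff ℝ ∞ E) (x : Coord × ℝ × ℝ) :
    HasFDerivAt (fun x : Coord × ℝ × ℝ => (x.1, E x))
      ((ContinuousLinearMap.fst ℝ Coord (ℝ × ℝ)).prod (fderiv ℝ E x)) x :=
  hasFDerivAt_fst.prodMk ((hE.differentiable (by simp)) x).hasFDerivAt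

/-- The set where `x ↦ (x.1, E x)` is a local diffeomorphism and injective, near the graph. -/
theorem exists_isOpen_injOn (hE : ContDiff ℝ ∞ E) (hH : Continuous H)
    (hE' : ∀ p : Coord, p.1 = 0 → ∀ w : ℝ × ℝ, fderiv ℝ E (p, H p) (0, w) = 0 → w = 0) :
    ∃ U : Set (Coord × ℝ × ℝ), IsOpen U ∧ (∀ p ∈ boundaryCell, (p, H p) ∈ U) ∧
      InjOn (fun x : Coord × ℝ × ℝ => (x.1, E x)) U ∧
      ∀ x ∈ U, ∃ e : (Coord × ℝ × ℝ) ≃L[ℝ] (Coord × ℝ × ℝ),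
        HasFDerivAt (fun x : Coord × ℝ × ℝ => (x.1, E x)) (e : _ →L[ℝ] _) x := by
  set T : Coord × ℝ × ℝ → Coord × ℝ × ℝ := fun x => (x.1, E x) with hT
  have hTs : ContDiff ℝ ∞ T := contDiff_fst.prodMk hE
  have hfd : Continuous (fderiv ℝ T) := hTs.continuous_fderiv (by simp)
  set U₁ : Set (Coord × ℝ × ℝ) := fderiv ℝ T ⁻¹'
    range ((↑) : ((Coord × ℝ × ℝ) ≃L[ℝ] (Coord × ℝ × ℝ)) → _ →L[ℝ] _) with hU₁
  have hU₁o : IsOpen U₁ := ContinuousLinearEquiv.isOpen.preimage hfd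
  have hU₁e : ∀ x ∈ U₁, ∃ e : (Coord × ℝ × ℝ) ≃L[ℝ] (Coord × ℝ × ℝ),
      HasFDerivAt T (e : _ →L[ℝ] _) x := by
    rintro x ⟨e, he⟩
    exact ⟨e, he ▸ ((hTs.differentiable (by simp)) x).hasFDerivAt⟩
  -- The derivative of `(p, z) ↦ (p, E (p, z))` is block triangular with an identity block, so
  -- injectivity in the `z` directions is enough.
  have hKU₁ : ∀ p ∈ boundaryCell, (p, H p) ∈ U₁ := by
    intro p hp
    have hp0 : p.1 = 0 := hp.1
    obtain ⟨e, he⟩ := exists_equiv_of_injective (fderiv ℝ T (p, H p)) (by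
      rw [(hasFDerivAt_prodMk_fst hE (p, H p)).fderiv]
      rintro ⟨v, w⟩ h
      rw [ContinuousLinearMap.prod_apply, Prod.mk_eq_zero] at h
      have hv : v = 0 := h.1
      subst hv
      rw [hE' p hp0 w h.2]
      rfl)
    exact ⟨e, he⟩
  set K : Set (Coord × ℝ × ℝ) := (fun p => (p, H p)) '' boundaryCell with hKdef
  have hc : IsCompact K := isCompact_boundaryCell.image (by fun_prop)
  have hinj : InjOn T K := by
    rintro _ ⟨p, hp, rfl⟩ _ ⟨q, hq, rfl⟩ h
    have : p = q := congrArg Prod.fst h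
    rw [this]
  -- A map that is injective on a compact set and locally injective near each of its points is
  -- injective on a neighbourhood of the set.
  obtain ⟨U₀, hU₀o, hKU₀, hU₀⟩ := hinj.exists_isOpen_superset hc
    (fun x _ => hTs.continuous.continuousAt) (by
      rintro _ ⟨p, hp, rfl⟩
      obtain ⟨e, he⟩ := hU₁e _ (hKU₁ p hp)
      have hs := hTs.contDiffAt.hasStrictFDerivAt' he (by simp)
      refine ⟨(hs.toOpenPartialHomeomorph T).source,
        (hs.toOpenPartialHomeomorph T).open_source.mem_nhds
          hs.mem_toOpenPartialHomeomorph_source, ?_⟩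
      exact (hs.toOpenPartialHomeomorph T).injOn)
  exact ⟨U₀ ∩ U₁, hU₀o.inter hU₁o, fun p hp => ⟨hKU₀ ⟨p, hp, rfl⟩, hKU₁ p hp⟩,
    hU₀.mono inter_subset_left, fun x hx => hU₁e x hx.2⟩

theorem isOpen_image_of_hasFDerivAt_equiv (hE : ContDiff ℝ ∞ E) {V : Set (Coord × ℝ × ℝ)}
    (hV : IsOpen V) (he : ∀ x ∈ V, ∃ e : (Coord × ℝ × ℝ) ≃L[ℝ] (Coord × ℝ × ℝ),
        HasFDerivAt (fun x : Coord × ℝ × ℝ => (x.1, E x)) (e : _ →L[ℝ] _) x) :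
    IsOpen ((fun x : Coord × ℝ × ℝ => (x.1, E x)) '' V) := by
  have hTs : ContDiff ℝ ∞ (fun x : Coord × ℝ × ℝ => (x.1, E x)) := contDiff_fst.prodMk hE
  rw [isOpen_iff_mem_nhds]
  rintro _ ⟨x, hx, rfl⟩
  obtain ⟨e, he⟩ := he x hx
  rw [← (hTs.contDiffAt.hasStrictFDerivAt' he (by simp)).map_nhds_eq_of_equiv]
  exact image_mem_map (hV.mem_nhds hx)

/-- A solution of `E (p, z) = 0` that is smooth near each point, obtained by the inverse function
theorem. -/
theorem contDiffAt_of_unique (hE : ContDiff ℝ ∞ E) {S : Coord → ℝ × ℝ} {p₀ : Coord}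
    (h0 : E (p₀, S p₀) = 0) {e : (Coord × ℝ × ℝ) ≃L[ℝ] (Coord × ℝ × ℝ)}
    (he : HasFDerivAt (fun x : Coord × ℝ × ℝ => (x.1, E x)) (e : _ →L[ℝ] _) (p₀, S p₀))
    (huniq : ∀ᶠ x in 𝓝 (p₀, S p₀), E x = 0 → x.2 = S x.1) : ContDiffAt ℝ ∞ S p₀ := by
  have hTs : ContDiff ℝ ∞ (fun x : Coord × ℝ × ℝ => (x.1, E x)) := contDiff_fst.prodMk hE
  have hs := hTs.contDiffAt.hasStrictFDerivAt' he (by simp)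
  set g := hTs.contDiffAt.localInverse he (by simp) with hg
  have hgs : ContDiffAt ℝ ∞ g (p₀, (0 : ℝ × ℝ)) := by
    have := hTs.contDiffAt.to_localInverse he (by simp)
    simpa only [h0] using this
  have hg0 : g (p₀, (0 : ℝ × ℝ)) = (p₀, S p₀) := by
    have := hTs.contDiffAt.localInverse_apply_image he (by simp)
    simpa only [h0] using this
  have hr : ∀ᶠ y in 𝓝 (p₀, (0 : ℝ × ℝ)), ((g y).1, E (g y)) = y := by
    have := hs.eventually_right_inverse
    simp only [h0] at this
    exact this
  have hι : ContDiffAt ℝ ∞ (fun p : Coord => (p, (0 : ℝ × ℝ))) p₀ := by fun_prop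
  have hgι : ContDiffAt ℝ ∞ (fun p : Coord => (g (p, 0)).2) p₀ :=
    contDiffAt_snd.comp p₀ (hgs.comp p₀ hι)
  refine hgι.congr_of_eventuallyEq ?_
  have h1 : ∀ᶠ p in 𝓝 p₀, ((g (p, (0 : ℝ × ℝ))).1, E (g (p, 0))) = (p, 0) :=
    hι.continuousAt.eventually hr
  have h2 : Tendsto (fun p : Coord => g (p, (0 : ℝ × ℝ))) (𝓝 p₀) (𝓝 (p₀, S p₀)) := by
    have := (hgs.comp p₀ hι).continuousAt.tendsto
    simpa only [Function.comp_def, hg0] using this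
  filter_upwards [h1, h2.eventually huniq] with p h3 h4
  rw [Prod.mk.injEq] at h3
  rw [h4 h3.2, h3.1]

/-- The implicit function theorem for an equation `E (p, z) = 0` that is equivariant under lattice
translations, with a known nondegenerate solution `z = H p` at `t = 0`: the solution extends
smoothly and uniquely to a uniform neighbourhood of the boundary. -/
theorem exists_implicit_of_equivariant (hE : ContDiff ℝ ∞ E) (hH : Continuous H)
    (hHt : ∀ p, H (0, p.2) = H p)
    (hE0 : ∀ p : Coord, p.1 = 0 → E (p, H p) = 0)
    (hE' : ∀ p : Coord, p.1 = 0 → ∀ w : ℝ × ℝ, fderiv ℝ E (p, H p) (0, w) = 0 → w = 0)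
    (hEs : ∀ n m p z, E (p + latticeShift n m, z + (latticeShift n m).2) = E (p, z))
    (hHs : ∀ n m p, H (p + latticeShift n m) = H p + (latticeShift n m).2) :
    ∃ δ > 0, ∃ κ > 0, ∃ S : Coord → ℝ × ℝ,
      (∀ p : Coord, |p.1| < δ → E (p, S p) = 0 ∧ ContDiffAt ℝ ∞ S p) ∧
      (∀ (p : Coord) (z w : ℝ × ℝ), |p.1| < δ → dist z (H p) < κ → dist w (H p) < κ →
        E (p, z) = 0 → E (p, w) = 0 → z = w) ∧
      (∀ κ' > 0, ∃ δ' > 0, ∀ p : Coord, |p.1| < δ' → dist (S p) (H p) < κ') ∧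
      ∀ n m p, |p.1| < δ → S (p + latticeShift n m) = S p + (latticeShift n m).2 := by
  obtain ⟨U, hUo, hKU, hUinj, hUe⟩ := exists_isOpen_injOn hE hH hE'
  obtain ⟨ε, hε, hεU⟩ := exists_uniform_of_isOpen hUo hH hHt hKU
  -- Equivariance moves `p` and both candidates to the compact cell, where injectivity on `U`
  -- separates solutions.
  have huniq : ∀ (p : Coord) (z w : ℝ × ℝ), |p.1| < ε → dist z (H p) < ε → dist w (H p) < ε →
        E (p, z) = 0 → E (p, w) = 0 → z = w := by
    intro p z w h1 h2 h3 h4 h5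
    obtain ⟨n, m, q, rfl, hq, hq1, hq2⟩ := exists_latticeShift p
    obtain ⟨z, rfl⟩ : ∃ z', z = z' + (latticeShift n m).2 := ⟨z - _, (sub_add_cancel _ _).symm⟩
    obtain ⟨w, rfl⟩ : ∃ z', w = z' + (latticeShift n m).2 := ⟨w - _, (sub_add_cancel _ _).symm⟩
    rw [hEs] at h4 h5
    rw [hHs, dist_add_right] at h2 h3
    rw [← hq] at h1
    have := hUinj (hεU q z h1 hq1 hq2 h2) (hεU q w h1 hq1 hq2 h3) (by simp only [h4, h5])
    rw [Prod.mk.injEq] at this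
    rw [this.2]
  have hex : ∀ κ' > 0, ∃ δ' > 0, ∀ p : Coord, |p.1| < δ' →
      ∃ z, E (p, z) = 0 ∧ dist z (H p) < κ' := by
    intro κ' hκ'
    -- The image of `V` under `(p, z) ↦ (p, E (p, z))` is open and contains `(p, 0)` for `p` in the
    -- cell, hence also for all `p` close to it; a preimage of `(p, 0)` is a solution.
    set V : Set (Coord × ℝ × ℝ) := U ∩ {x | dist x.2 (H x.1) < κ'} with hV
    have hVo : IsOpen V := hUo.inter (isOpen_lt (by fun_prop) continuous_const)
    have hTV := isOpen_image_of_hasFDerivAt_equiv hE hVo (fun x hx => hUe x hx.1)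
    obtain ⟨δ', hδ', h⟩ := exists_uniform_of_isOpen (H := fun _ => 0) hTV continuous_const
      (fun _ => rfl) (fun p hp => ⟨(p, H p), ⟨hKU p hp, by simpa using hκ'⟩, by
        simp only [hE0 p hp.1]⟩)
    refine ⟨δ', hδ', fun p hp => ?_⟩
    obtain ⟨n, m, q, rfl, hq, hq1, hq2⟩ := exists_latticeShift p
    rw [← hq] at hp
    obtain ⟨⟨q', z⟩, ⟨-, hz⟩, hx⟩ := h q 0 hp hq1 hq2 (by simpa using hδ')
    rw [Prod.mk.injEq] at hx
    obtain ⟨hx1, hx2⟩ := hx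
    simp only at hx1
    subst hx1
    refine ⟨z + (latticeShift n m).2, by rw [hEs, hx2], ?_⟩
    rw [hHs, dist_add_right]
    exact hz
  obtain ⟨δ₁, hδ₁, hδ₁ex⟩ := hex ε hε
  -- `S` is chosen point by point. Its equivariance and smoothness both come afterwards, from
  -- uniqueness.
  choose! S hS0 hSd using hδ₁ex
  set δ := min δ₁ ε with hδ
  have hδ0 : 0 < δ := lt_min hδ₁ hε
  have hlt₁ : ∀ {x : ℝ}, x < δ → x < δ₁ := fun h => h.trans_le (min_le_left _ _)
  have hltε : ∀ {x : ℝ}, x < δ → x < ε := fun h => h.trans_le (min_le_right _ _)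
  have hSs : ∀ n m p, |p.1| < δ → S (p + latticeShift n m) = S p + (latticeShift n m).2 := by
    intro n m p hp
    have hp' : |(p + latticeShift n m).1| < δ := by simpa [latticeShift] using hp
    refine huniq (p + latticeShift n m) _ _ (hltε hp') (hSd _ (hlt₁ hp')) ?_ (hS0 _ (hlt₁ hp')) ?_
    · rw [hHs, dist_add_right]; exact hSd p (hlt₁ hp)
    · rw [hEs]; exact hS0 p (hlt₁ hp)
  have hstrip : IsOpen {p : Coord | |p.1| < δ} := isOpen_lt (by fun_prop) continuous_const
  have hsm : ∀ q : Coord, |q.1| < δ → q.2.1 ∈ Icc 0 (2 * Real.pi) →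
      q.2.2 ∈ Icc 0 (2 * Real.pi) → ContDiffAt ℝ ∞ S q := by
    intro q hq hq1 hq2
    obtain ⟨e, he⟩ := hUe _ (hεU q (S q) (hltε hq) hq1 hq2 (hSd q (hlt₁ hq)))
    refine contDiffAt_of_unique hE (hS0 q (hlt₁ hq)) he ?_
    have h1 : ∀ᶠ x : Coord × ℝ × ℝ in 𝓝 (q, S q), |x.1.1| < δ :=
      (isOpen_lt (by fun_prop) continuous_const).mem_nhds hq
    have h2 : ∀ᶠ x : Coord × ℝ × ℝ in 𝓝 (q, S q), dist x.2 (H x.1) < ε :=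
      (isOpen_lt (by fun_prop) continuous_const).mem_nhds (hSd q (hlt₁ hq))
    filter_upwards [h1, h2] with x h1 h2 h3
    exact huniq x.1 _ _ (hltε h1) h2 (hSd _ (hlt₁ h1)) h3 (hS0 _ (hlt₁ h1))
  refine ⟨δ, hδ0, ε, hε, S, fun p hp => ⟨hS0 p (hlt₁ hp), ?_⟩,
    fun p z w h => huniq p z w (hltε h), fun κ' hκ' => ?_, hSs⟩
  · obtain ⟨n, m, q, rfl, hq, hq1, hq2⟩ := exists_latticeShift p
    rw [← hq] at hp
    have h1 : ContDiffAt ℝ ∞ (fun p => S (p - latticeShift n m) + (latticeShift n m).2)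
        (q + latticeShift n m) := by
      refine ContDiffAt.add ?_ contDiffAt_const
      refine ContDiffAt.comp (g := S) (f := fun p => p - latticeShift n m) (q + latticeShift n m) ?_
        (by fun_prop)
      rw [add_sub_cancel_right]
      exact hsm q hp hq1 hq2
    refine h1.congr_of_eventuallyEq ?_
    have : q + latticeShift n m ∈ {p : Coord | |p.1| < δ} := by simpa [latticeShift] using hp
    filter_upwards [hstrip.mem_nhds this] with p hp
    have hp' : |(p - latticeShift n m).1| < δ := by simpa [latticeShift] using hp
    rw [← hSs n m _ hp', sub_add_cancel]
  · obtain ⟨δ', hδ', h⟩ := hex (min κ' ε) (lt_min hκ' hε)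
    refine ⟨min δ' δ, lt_min hδ' hδ0, fun p hp => ?_⟩
    have hpδ : |p.1| < δ := hp.trans_le (min_le_right _ _)
    obtain ⟨z, hz, hzd⟩ := h p (hp.trans_le (min_le_left _ _))
    rw [huniq p (S p) z (hltε hpδ) (hSd p (hlt₁ hpδ)) (hzd.trans_le (min_le_right _ _))
      (hS0 p (hlt₁ hpδ)) hz]
    exact hzd.trans_le (min_le_left _ _)

end

/-! ### Boundary maps and the Schwarzian transformation -/

theorem iteratedDeriv_three {f : ℝ → ℝ} : iteratedDeriv 3 f = deriv (deriv (deriv f)) := by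
  rw [iteratedDeriv_succ, iteratedDeriv_succ, iteratedDeriv_one]

theorem iteratedDeriv_two_eq {f : ℝ → ℝ} : iteratedDeriv 2 f = deriv (deriv f) := by
  rw [iteratedDeriv_succ, iteratedDeriv_one]

theorem contDiff_deriv {f : ℝ → ℝ} (hf : ContDiff ℝ ∞ f) : ContDiff ℝ ∞ (deriv f) :=
  (contDiff_infty_iff_deriv.1 hf).2

theorem hasDerivAt_of_contDiff {f : ℝ → ℝ} (hf : ContDiff ℝ ∞ f) (x : ℝ) :
    HasDerivAt f (deriv f x) x :=
  ((hf.differentiable (by simp)) x).hasDerivAt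

theorem deriv_add_period {f : ℝ → ℝ} {T C : ℝ} (hf : ∀ x, f (x + T) = f x + C) :
    Function.Periodic (deriv f) T := by
  intro x
  rw [← deriv_comp_add_const, funext hf, deriv_add_const]

/-- The exponent `Ψ = log h'` of a boundary map. -/
noncomputable def logDerivative (h : ℝ → ℝ) (x : ℝ) : ℝ := Real.log (deriv h x)

namespace IsBoundaryMap

variable {h : ℝ → ℝ} (hh : IsBoundaryMap h)
include hh

theorem periodic_deriv : Function.Periodic (deriv h) (2 * Real.pi) :=
  deriv_add_period hh.quasiperiodic

theorem exp_logDerivative (x : ℝ) : Real.exp (logDerivative h x) = deriv h x :=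
  Real.exp_log (hh.deriv_pos x)

theorem contDiff_logDerivative : ContDiff ℝ ∞ (logDerivative h) :=
  (contDiff_deriv hh.smooth).log fun x => (hh.deriv_pos x).ne'

theorem periodic_logDerivative : Function.Periodic (logDerivative h) (2 * Real.pi) := fun x => by
  rw [logDerivative, hh.periodic_deriv x, logDerivative]

theorem deriv_deriv (x : ℝ) :
    deriv (deriv h) x = deriv (logDerivative h) x * Real.exp (logDerivative h x) := by
  have h1 : deriv h = fun x => Real.exp (logDerivative h x) :=
    funext fun x => (hh.exp_logDerivative x).symm
  conv_lhs => rw [h1]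
  rw [(hasDerivAt_of_contDiff hh.contDiff_logDerivative x).exp.deriv, mul_comm]

theorem deriv_deriv_deriv (x : ℝ) :
    deriv (deriv (deriv h)) x = (deriv (deriv (logDerivative h)) x + deriv (logDerivative h) x ^ 2)
      * Real.exp (logDerivative h x) := by
  rw [funext hh.deriv_deriv]
  have h1 := hasDerivAt_of_contDiff hh.contDiff_logDerivative x
  have h2 := hasDerivAt_of_contDiff (contDiff_deriv hh.contDiff_logDerivative) x
  refine (h2.mul h1.exp).deriv.trans ?_
  ring

/-- With `h' = e^Ψ` one has `h''/h' = Ψ'` and `h'''/h' = Ψ'' + Ψ'²`, so the Schwarzian is `Ψ'' -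
Ψ'²/2`. -/
theorem transformedL_eq (L : ℝ → ℝ) (x : ℝ) :
    transformedL L h x = Real.exp (2 * logDerivative h x) * L (h x) +
      1 / 4 * deriv (logDerivative h) x ^ 2 - 1 / 2 * deriv (deriv (logDerivative h)) x := by
  rw [transformedL, schwarzian, iteratedDeriv_three, iteratedDeriv_two_eq,
    hh.deriv_deriv_deriv, hh.deriv_deriv, ← hh.exp_logDerivative,
    two_mul (logDerivative h x), Real.exp_add]
  have := (Real.exp_pos (logDerivative h x)).ne'
  field_simp
  ring

theorem isBanadosFunction_transformedL {L : ℝ → ℝ} (hL : IsBanadosFunction L) :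
    IsBanadosFunction (transformedL L h) := by
  have hs := hh.contDiff_logDerivative
  have hs' := contDiff_deriv hs
  refine ⟨?_, fun x => ?_⟩
  · rw [funext (hh.transformedL_eq L)]
    exact ((contDiff_const.mul hs).exp.mul (hL.smooth.comp hh.smooth)).add
      (contDiff_const.mul (hs'.pow 2)) |>.sub (contDiff_const.mul (contDiff_deriv hs'))
  · have p1 := hh.periodic_logDerivative
    have p2 : Function.Periodic (deriv (logDerivative h)) (2 * Real.pi) :=
      deriv_add_period (C := 0) fun x => by rw [p1 x, add_zero]
    have p3 : Function.Periodic (deriv (deriv (logDerivative h))) (2 * Real.pi) :=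
      deriv_add_period (C := 0) fun x => by rw [p2 x, add_zero]
    rw [hh.transformedL_eq, hh.transformedL_eq, p1 x, p2 x, p3 x, hh.quasiperiodic,
      hL.periodic (h x)]

theorem liouville_form (L : ℝ → ℝ) {Ψ : ℝ → ℝ} (hΨ : ∀ x, deriv h x = Real.exp (Ψ x)) :
    ContDiff ℝ ∞ Ψ ∧ Function.Periodic Ψ (2 * Real.pi) ∧
      ∀ x, transformedL L h x = Real.exp (2 * Ψ x) * L (h x) +
        1 / 4 * deriv Ψ x ^ 2 - 1 / 2 * iteratedDeriv 2 Ψ x := by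
  have e : Ψ = logDerivative h := funext fun x => by rw [logDerivative, hΨ, Real.log_exp]
  rw [e, iteratedDeriv_two_eq]
  exact ⟨hh.contDiff_logDerivative, hh.periodic_logDerivative, hh.transformedL_eq L⟩

/-- Since `h x - x` is periodic, `h` is unbounded in both directions, hence onto by the intermediate
value theorem; it is strictly increasing, so the inverse is an order isomorphism and continuous. -/
theorem exists_inverse : ∃ k : ℝ → ℝ, Continuous k ∧ (∀ x, k (h x) = x) ∧ (∀ x, h (k x) = x) ∧
    ∀ x, k (x + 2 * Real.pi) = k x + 2 * Real.pi := by
  have hmono : StrictMono h := strictMono_of_deriv_pos hh.deriv_pos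
  have hcont : Continuous h := hh.smooth.continuous
  have hint : ∀ (n : ℤ) (x : ℝ), h (x + n * (2 * Real.pi)) = h x + n * (2 * Real.pi) := by
    intro n x
    have hp : Function.Periodic (fun x => h x - x) (2 * Real.pi) := fun x => by
      simp only [hh.quasiperiodic]; ring
    have := hp.int_mul n x
    linarith
  have hsurj : Function.Surjective h := by
    intro y
    have hπ := Real.two_pi_pos
    obtain ⟨n, hn⟩ := exists_int_gt ((y - h 0) / (2 * Real.pi))
    obtain ⟨m, hm⟩ := exists_int_lt ((y - h 0) / (2 * Real.pi))
    rw [div_lt_iff₀ hπ] at hn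
    rw [lt_div_iff₀ hπ] at hm
    have h1 := hint n 0
    have h2 := hint m 0
    exact mem_range_of_exists_le_of_exists_ge hcont ⟨_, by rw [h2]; linarith⟩
      ⟨_, by rw [h1]; linarith⟩
  let e := hmono.orderIsoOfSurjective h hsurj
  have h2 : ∀ x, h (e.symm x) = x := fun x => hmono.orderIsoOfSurjective_self_symm_apply h hsurj x
  refine ⟨e.symm, e.symm.continuous, fun x => ?_, h2, fun x => ?_⟩
  · exact hmono.orderIsoOfSurjective_symm_apply_self h hsurj x
  · apply hmono.injective
    rw [hh.quasiperiodic, h2, h2]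

end IsBoundaryMap

/-- The transform `u ↦ u ∘ h / √h'` of solutions of Hill's equation, that is, of
densities of weight `-1/2`. -/
noncomputable def hillTransform (u h : ℝ → ℝ) (x : ℝ) : ℝ :=
  Real.exp (-(logDerivative h x) / 2) * u (h x)

theorem exp_logDerivative_half_mul (h : ℝ → ℝ) (x : ℝ) :
    Real.exp (-(logDerivative h x) / 2) * Real.exp (logDerivative h x / 2) = 1 := by
  rw [← Real.exp_add, neg_div, neg_add_cancel, Real.exp_zero]

/-! ### Covariance of Hill's equation under boundary maps -/

namespace IsBoundaryMap

variable {h : ℝ → ℝ} (hh : IsBoundaryMap h)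
include hh

theorem contDiff_hillTransform {u : ℝ → ℝ} (hu : ContDiff ℝ ∞ u) :
    ContDiff ℝ ∞ (hillTransform u h) :=
  (hh.contDiff_logDerivative.neg.div_const 2).exp.mul (hu.comp hh.smooth)

theorem deriv_eq_exp_mul_exp (x : ℝ) :
    deriv h x = Real.exp (logDerivative h x / 2) * Real.exp (logDerivative h x / 2) := by
  rw [← Real.exp_add, add_halves, hh.exp_logDerivative]

theorem deriv_hillTransform {u : ℝ → ℝ} (hu : ContDiff ℝ ∞ u) :
    deriv (hillTransform u h) = fun x => Real.exp (logDerivative h x / 2) * deriv u (h x) -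
      1 / 2 * deriv (logDerivative h) x * hillTransform u h x := by
  funext x
  have h1 := ((hasDerivAt_of_contDiff hh.contDiff_logDerivative x).neg.div_const 2).exp
  have h2 := (hasDerivAt_of_contDiff hu (h x)).comp x (hasDerivAt_of_contDiff hh.smooth x)
  have h3 : HasDerivAt (hillTransform u h) _ x := h1.mul h2
  rw [h3.deriv, hh.deriv_eq_exp_mul_exp, hillTransform]
  have := exp_logDerivative_half_mul h x
  simp only [Pi.neg_apply]
  linear_combination (deriv u (h x) * Real.exp (logDerivative h x / 2)) * this

/-- The weight `-1/2` is the one for which the terms with `u' ∘ h` cancel in the second derivative.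
What remains is `e^{2Ψ} L ∘ h + Ψ'²/4 - Ψ''/2` times the transform: this is the source of the
Schwarzian. -/
theorem hasDerivAt_deriv_hillTransform {L u : ℝ → ℝ} (hu : ContDiff ℝ ∞ u)
    (hL : ∀ x, HasDerivAt (deriv u) (L x * u x) x) (x : ℝ) :
    HasDerivAt (deriv (hillTransform u h)) (transformedL L h x * hillTransform u h x) x := by
  have hΨ := hasDerivAt_of_contDiff hh.contDiff_logDerivative x
  have hΨ' := hasDerivAt_of_contDiff (contDiff_deriv hh.contDiff_logDerivative) x
  have h1 := (hΨ.div_const 2).exp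
  have h2 := (hL (h x)).comp x (hasDerivAt_of_contDiff hh.smooth x)
  have h4 := hasDerivAt_of_contDiff (hh.contDiff_hillTransform hu) x
  have h5 := (h1.mul h2).sub ((hΨ'.const_mul (1 / 2)).mul h4)
  have e := hh.deriv_hillTransform hu
  conv => arg 1; rw [e]
  refine h5.congr_deriv ?_
  rw [hh.transformedL_eq, e, hh.deriv_eq_exp_mul_exp]
  simp only [Function.comp_apply, hillTransform]
  have e2 : Real.exp (2 * logDerivative h x) * Real.exp (-(logDerivative h x) / 2) =
      Real.exp (logDerivative h x / 2) * (Real.exp (logDerivative h x / 2) *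
        Real.exp (logDerivative h x / 2)) := by
    rw [← Real.exp_add, ← Real.exp_add, ← Real.exp_add]
    congr 1
    ring
  linear_combination (-(L (h x) * u (h x))) * e2

/-- The terms with `Ψ'` are proportional to the functions themselves and drop out; the factors
`e^{-Ψ/2}` and `e^{Ψ/2}` cancel. -/
theorem hillTransform_wronskian {c s : ℝ → ℝ} (hc : ContDiff ℝ ∞ c) (hs : ContDiff ℝ ∞ s)
    (x : ℝ) : hillTransform c h x * deriv (hillTransform s h) x -
      deriv (hillTransform c h) x * hillTransform s h x =
        c (h x) * deriv s (h x) - deriv c (h x) * s (h x) := by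
  rw [hh.deriv_hillTransform hc, hh.deriv_hillTransform hs]
  have := exp_logDerivative_half_mul h x
  simp only [hillTransform]
  linear_combination (c (h x) * deriv s (h x) - deriv c (h x) * s (h x)) * this

theorem isHillBasis_hillTransform {L c s : ℝ → ℝ} (hb : IsHillBasis L c s) :
    IsHillBasis (transformedL L h) (hillTransform c h) (hillTransform s h) :=
  ⟨hh.contDiff_hillTransform hb.smooth_fst, hh.contDiff_hillTransform hb.smooth_snd,
    hh.hasDerivAt_deriv_hillTransform hb.smooth_fst hb.hill_fst,
    hh.hasDerivAt_deriv_hillTransform hb.smooth_snd hb.hill_snd,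
    fun x => by rw [hh.hillTransform_wronskian hb.smooth_fst hb.smooth_snd, hb.wronskian]⟩

end IsBoundaryMap

/-! ### The local embedding into `2 × 2` matrices -/

/-- The space of `2 × 2` matrices, written as `(m₀₀, m₀₁, m₁₀, m₁₁)`. -/
abbrev Quad : Type := ℝ × ℝ × ℝ × ℝ

/-- The polarization of the determinant. -/
noncomputable def polar (a b : Quad) : ℝ :=
  (a.1 * b.2.2.2 + a.2.2.2 * b.1 - a.2.1 * b.2.2.1 - a.2.2.1 * b.2.1) / 2

/-- The rank-one matrix with entries `uᵢ wⱼ`. -/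
def dyad (u₀ u₁ w₀ w₁ : ℝ) : Quad := (u₀ * w₀, u₀ * w₁, u₁ * w₀, u₁ * w₁)

theorem polar_comm (a b : Quad) : polar a b = polar b a := by simp only [polar]; ring

theorem polar_add_left (a b c : Quad) : polar (a + b) c = polar a c + polar b c := by
  simp only [polar, Prod.fst_add, Prod.snd_add]; ring

theorem polar_smul_left (r : ℝ) (a b : Quad) : polar (r • a) b = r * polar a b := by
  simp only [polar, Prod.smul_fst, Prod.smul_snd, smul_eq_mul]; ring

theorem polar_add_right (a b c : Quad) : polar a (b + c) = polar a b + polar a c := by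
  rw [polar_comm, polar_add_left, polar_comm b, polar_comm c]

theorem polar_smul_right (r : ℝ) (a b : Quad) : polar a (r • b) = r * polar a b := by
  rw [polar_comm, polar_smul_left, polar_comm]

theorem polar_sub_left (a b c : Quad) : polar (a - b) c = polar a c - polar b c := by
  simp only [polar, Prod.fst_sub, Prod.snd_sub]; ring

theorem polar_sub_right (a b c : Quad) : polar a (b - c) = polar a b - polar a c := by
  rw [polar_comm, polar_sub_left, polar_comm b, polar_comm c]

theorem polar_dyad (a b c d a' b' c' d' : ℝ) :
    polar (dyad a b c d) (dyad a' b' c' d') = (a * b' - b * a') * (c * d' - d * c') / 2 := by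
  simp only [polar, dyad]; ring

/-- `polar` as a continuous bilinear map. -/
noncomputable def polarCLM : Quad →L[ℝ] Quad →L[ℝ] ℝ :=
  (LinearMap.mk₂ ℝ polar polar_add_left polar_smul_left polar_add_right
    polar_smul_right).toContinuousBilinearMap

theorem polarCLM_apply (a b : Quad) : polarCLM a b = polar a b := rfl

theorem fderiv_polar_apply {E : Type*} [NormedAddCommGroup E] [NormedSpace ℝ E] {f g : E → Quad}
    {p : E} (hf : DifferentiableAt ℝ f p) (hg : DifferentiableAt ℝ g p) (v : E) :
    fderiv ℝ (fun q => polar (f q) (g q)) p v =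
      polar (f p) (fderiv ℝ g p v) + polar (fderiv ℝ f p v) (g p) := by
  have := polarCLM.hasFDerivAt_of_bilinear hf.hasFDerivAt hg.hasFDerivAt
  simp only [polarCLM_apply] at this
  rw [this.fderiv]
  rfl

theorem hasDerivAt_polar {f g : ℝ → Quad} {f' g' : Quad} {x : ℝ} (hf : HasDerivAt f f' x)
    (hg : HasDerivAt g g' x) :
    HasDerivAt (fun q => polar (f q) (g q)) (polar (f x) g' + polar f' (g x)) x := by
  have := (polarCLM.hasFDerivAt_of_bilinear hf.hasFDerivAt hg.hasFDerivAt).hasDerivAt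
  simpa [polarCLM_apply] using this

/-- Expansion of a matrix in the dyadic basis of two frames of Wronskian `1`. -/
theorem quad_expansion {a b a' b' c d c' d' : ℝ} (h₁ : a * b' - a' * b = 1)
    (h₂ : c * d' - c' * d = 1) (B : Quad) :
    B = (2 * polar B (dyad a' b' c' d')) • dyad a b c d
      - (2 * polar B (dyad a b c' d')) • dyad a' b' c d
      - (2 * polar B (dyad a' b' c d)) • dyad a b c' d'
      + (2 * polar B (dyad a b c d)) • dyad a' b' c' d' := by
  -- Inserting the product of the Wronskians, which is `1`, turns each entry into a polynomial
  -- identity.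
  have key : ∀ x : ℝ, x = x * ((a * b' - a' * b) * (c * d' - c' * d)) := by
    intro x; rw [h₁, h₂]; ring
  ext <;>
  simp only [polar, dyad, Prod.fst_add, Prod.snd_add, Prod.fst_sub, Prod.snd_sub, Prod.smul_fst,
    Prod.smul_snd, smul_eq_mul]
  · refine (key B.1).trans ?_; ring
  · refine (key B.2.1).trans ?_; ring
  · refine (key B.2.2.1).trans ?_; ring
  · refine (key B.2.2.2).trans ?_; ring

/-- The map `r ψ₊ ψ₋ᵀ - (ℓ² / r) ψ₊' ψ₋'ᵀ` built from solutions `ψ₊ = (c₊, s₊)`, `ψ₋ = (c₋, s₋)` of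
Hill's equations. It embeds the Bañados geometry locally into the quadric `det = -ℓ²`. -/
noncomputable def hillEmbedding (ℓ : ℝ) (cp sp cm sm : ℝ → ℝ) (p : Coord) : Quad :=
  p.1 • dyad (cp p.2.1) (sp p.2.1) (cm p.2.2) (sm p.2.2) -
    (ℓ ^ 2 / p.1) • dyad (deriv cp p.2.1) (deriv sp p.2.1) (deriv cm p.2.2) (deriv sm p.2.2)

theorem hasDerivAt_embedding_component {ℓ Lp Lm : ℝ} {u w : ℝ → ℝ} {p : Coord} (hp : p.1 ≠ 0)
    (hu : HasDerivAt u (deriv u p.2.1) p.2.1) (hw : HasDerivAt w (deriv w p.2.2) p.2.2)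
    (hu' : HasDerivAt (deriv u) (Lp * u p.2.1) p.2.1)
    (hw' : HasDerivAt (deriv w) (Lm * w p.2.2) p.2.2) (v : Coord) :
    HasDerivAt (fun s : ℝ => (p.1 + s * v.1) * (u (p.2.1 + s * v.2.1) * w (p.2.2 + s * v.2.2)) -
        ℓ ^ 2 / (p.1 + s * v.1) *
          (deriv u (p.2.1 + s * v.2.1) * deriv w (p.2.2 + s * v.2.2)))
      (v.1 * (u p.2.1 * w p.2.2 + ℓ ^ 2 / p.1 ^ 2 * (deriv u p.2.1 * deriv w p.2.2)) +
        v.2.1 * (p.1 * (deriv u p.2.1 * w p.2.2) - ℓ ^ 2 / p.1 * Lp * (u p.2.1 * deriv w p.2.2)) +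
        v.2.2 * (p.1 * (u p.2.1 * deriv w p.2.2) - ℓ ^ 2 / p.1 * Lm * (deriv u p.2.1 * w p.2.2)))
      0 := by
  have lin : ∀ x y : ℝ, HasDerivAt (fun s : ℝ => x + s * y) y 0 := fun x y => by
    simpa using ((hasDerivAt_id (0 : ℝ)).mul_const y).const_add x
  have hc : ∀ {f : ℝ → ℝ} {f' x : ℝ} (y : ℝ), HasDerivAt f f' x →
      HasDerivAt (fun s : ℝ => f (x + s * y)) (f' * y) 0 := fun {f f' x} y hf => by
    have h0 : HasDerivAt f f' (x + 0 * y) := by simpa using hf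
    exact h0.comp (0 : ℝ) (lin x y)
  have hr := lin p.1 v.1
  have hri := (hasDerivAt_const (0 : ℝ) (ℓ ^ 2)).div hr (by simpa using hp)
  refine ((hr.mul ((hc v.2.1 hu).mul (hc v.2.2 hw))).sub
    (hri.mul ((hc v.2.1 hu').mul (hc v.2.2 hw')))).congr_deriv ?_
  simp only [zero_mul, add_zero, Pi.mul_apply, Pi.div_apply]
  field_simp
  ring

/-! ### The Bañados metric as the induced metric -/

section

variable {ℓ : ℝ} {Lp Lm cp sp cm sm : ℝ → ℝ}

theorem contDiffAt_hillEmbedding (hcp : ContDiff ℝ ∞ cp) (hsp : ContDiff ℝ ∞ sp)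
    (hcm : ContDiff ℝ ∞ cm) (hsm : ContDiff ℝ ∞ sm) {p : Coord} (hp : p.1 ≠ 0) :
    ContDiffAt ℝ ∞ (hillEmbedding ℓ cp sp cm sm) p := by
  have h1 := contDiff_deriv hcp
  have h2 := contDiff_deriv hsp
  have h3 := contDiff_deriv hcm
  have h4 := contDiff_deriv hsm
  have h5 : ContDiffAt ℝ ∞ (fun p : Coord => ℓ ^ 2 / p.1) p :=
    contDiffAt_const.div contDiffAt_fst hp
  unfold hillEmbedding dyad
  fun_prop

/-- Hill's equation removes second derivatives of the frames, so the tangent vectors stay in the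
span of the same four dyads as the position. Pairings then reduce to Wronskians. -/
theorem fderiv_hillEmbedding (hP : IsHillBasis Lp cp sp) (hM : IsHillBasis Lm cm sm) {p : Coord}
    (hp : p.1 ≠ 0) (v : Coord) :
    fderiv ℝ (hillEmbedding ℓ cp sp cm sm) p v =
      v.1 • (dyad (cp p.2.1) (sp p.2.1) (cm p.2.2) (sm p.2.2) + (ℓ ^ 2 / p.1 ^ 2) •
        dyad (deriv cp p.2.1) (deriv sp p.2.1) (deriv cm p.2.2) (deriv sm p.2.2)) +
      v.2.1 • (p.1 • dyad (deriv cp p.2.1) (deriv sp p.2.1) (cm p.2.2) (sm p.2.2) -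
        (ℓ ^ 2 / p.1 * Lp p.2.1) •
          dyad (cp p.2.1) (sp p.2.1) (deriv cm p.2.2) (deriv sm p.2.2)) +
      v.2.2 • (p.1 • dyad (cp p.2.1) (sp p.2.1) (deriv cm p.2.2) (deriv sm p.2.2) -
        (ℓ ^ 2 / p.1 * Lm p.2.2) •
          dyad (deriv cp p.2.1) (deriv sp p.2.1) (cm p.2.2) (sm p.2.2)) := by
  have hd : DifferentiableAt ℝ (hillEmbedding ℓ cp sp cm sm) p :=
    (contDiffAt_hillEmbedding hP.smooth_fst hP.smooth_snd hM.smooth_fst hM.smooth_snd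
      hp).differentiableAt (by simp)
  have hline : HasDerivAt (fun s : ℝ => p + s • v) v 0 := by
    simpa using ((hasDerivAt_id (0 : ℝ)).smul_const v).const_add p
  have hd0 : HasFDerivAt (hillEmbedding ℓ cp sp cm sm) (fderiv ℝ (hillEmbedding ℓ cp sp cm sm) p)
      (p + (0 : ℝ) • v) := by simpa using hd.hasFDerivAt
  have h1 := hd0.comp_hasDerivAt (0 : ℝ) hline
  have key : ∀ {u w : ℝ → ℝ}, _ → _ → _ → _ → _ := fun {u w} hu hw hu' hw' =>
    hasDerivAt_embedding_component (ℓ := ℓ) (Lp := Lp p.2.1) (Lm := Lm p.2.2) (u := u) (w := w) hp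
      hu hw hu' hw' v
  have dcp := hasDerivAt_of_contDiff hP.smooth_fst p.2.1
  have dsp := hasDerivAt_of_contDiff hP.smooth_snd p.2.1
  have dcm := hasDerivAt_of_contDiff hM.smooth_fst p.2.2
  have dsm := hasDerivAt_of_contDiff hM.smooth_snd p.2.2
  have h2 := (key dcp dcm (hP.hill_fst _) (hM.hill_fst _)).prodMk
    ((key dcp dsm (hP.hill_fst _) (hM.hill_snd _)).prodMk
    ((key dsp dcm (hP.hill_snd _) (hM.hill_fst _)).prodMk
    (key dsp dsm (hP.hill_snd _) (hM.hill_snd _))))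
  refine h1.unique (h2.congr_deriv ?_)
  ext <;>
  simp only [dyad, Prod.fst_add, Prod.snd_add, Prod.fst_sub, Prod.snd_sub, Prod.smul_fst,
    Prod.smul_snd, smul_eq_mul]

/-- Among the four dyads only two pairings survive: `ψ₊ψ₋ᵀ` with `ψ₊'ψ₋'ᵀ`, equal to `1/2`, and
`ψ₊'ψ₋ᵀ` with `ψ₊ψ₋'ᵀ`, equal to `-1/2`. -/
theorem banadosMetric_eq_polar (hP : IsHillBasis Lp cp sp) (hM : IsHillBasis Lm cm sm) {p : Coord}
    (hp : p.1 ≠ 0) (v w : Coord) :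
    banadosMetric ℓ Lp Lm p v w = polar (fderiv ℝ (hillEmbedding ℓ cp sp cm sm) p v)
      (fderiv ℝ (hillEmbedding ℓ cp sp cm sm) p w) := by
  rw [fderiv_hillEmbedding hP hM hp, fderiv_hillEmbedding hP hM hp]
  have h1 := hP.wronskian p.2.1
  have h2 := hM.wronskian p.2.2
  have e1 : sp p.2.1 * deriv cp p.2.1 = cp p.2.1 * deriv sp p.2.1 - 1 := by linarith
  have e2 : sm p.2.2 * deriv cm p.2.2 = cm p.2.2 * deriv sm p.2.2 - 1 := by linarith
  have e3 : deriv cp p.2.1 * sp p.2.1 = cp p.2.1 * deriv sp p.2.1 - 1 := by linarith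
  have e4 : deriv cm p.2.2 * sm p.2.2 = cm p.2.2 * deriv sm p.2.2 - 1 := by linarith
  simp only [polar_add_left, polar_add_right, polar_sub_left, polar_sub_right, polar_smul_left,
    polar_smul_right, polar_dyad, banadosMetric, e1, e2, e3, e4]
  field_simp
  ring

theorem polar_hillEmbedding_self (hP : IsHillBasis Lp cp sp) (hM : IsHillBasis Lm cm sm)
    {p : Coord} (hp : p.1 ≠ 0) :
    polar (hillEmbedding ℓ cp sp cm sm p) (hillEmbedding ℓ cp sp cm sm p) = -ℓ ^ 2 := by
  have h1 := hP.wronskian p.2.1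
  have h2 := hM.wronskian p.2.2
  have e1 : sp p.2.1 * deriv cp p.2.1 = cp p.2.1 * deriv sp p.2.1 - 1 := by linarith
  have e2 : sm p.2.2 * deriv cm p.2.2 = cm p.2.2 * deriv sm p.2.2 - 1 := by linarith
  have e3 : deriv cp p.2.1 * sp p.2.1 = cp p.2.1 * deriv sp p.2.1 - 1 := by linarith
  have e4 : deriv cm p.2.2 * sm p.2.2 = cm p.2.2 * deriv sm p.2.2 - 1 := by linarith
  simp only [hillEmbedding, polar_sub_left, polar_sub_right, polar_smul_left,
    polar_smul_right, polar_dyad, e1, e2, e3, e4]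
  field_simp
  ring

/-- The embedding is an immersion into the quadric wherever the metric is nondegenerate: a vector
orthogonal to the position and to all tangent vectors vanishes. -/
theorem eq_zero_of_polar_hillEmbedding (hℓ : ℓ ≠ 0) (hP : IsHillBasis Lp cp sp)
    (hM : IsHillBasis Lm cm sm)
    {p : Coord} (hp : p.1 ≠ 0) (hdet : ℓ ^ 4 * Lp p.2.1 * Lm p.2.2 ≠ p.1 ^ 4) {K : Quad}
    (h0 : polar K (hillEmbedding ℓ cp sp cm sm p) = 0)
    (hK : ∀ v, polar K (fderiv ℝ (hillEmbedding ℓ cp sp cm sm) p v) = 0) : K = 0 := by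
  have hr := hK (1, 0, 0)
  have ha := hK (0, 1, 0)
  have hb := hK (0, 0, 1)
  rw [fderiv_hillEmbedding hP hM hp] at hr ha hb
  simp only [hillEmbedding, zero_smul, one_smul, add_zero, zero_add, polar_add_right,
    polar_sub_right, polar_smul_right] at h0 hr ha hb
  rw [quad_expansion (hP.wronskian p.2.1) (hM.wronskian p.2.2) K]
  generalize polar K (dyad (cp p.2.1) (sp p.2.1) (cm p.2.2) (sm p.2.2)) = x at *
  generalize polar K (dyad (deriv cp p.2.1) (deriv sp p.2.1) (deriv cm p.2.2) (deriv sm p.2.2)) = y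
    at *
  generalize polar K (dyad (cp p.2.1) (sp p.2.1) (deriv cm p.2.2) (deriv sm p.2.2)) = z at *
  generalize polar K (dyad (deriv cp p.2.1) (deriv sp p.2.1) (cm p.2.2) (sm p.2.2)) = w at *
  -- The position and the radial vector determine `x = y = 0`. The two tangential equations form a
  -- linear system for `z`, `w` whose determinant is, up to sign, `r⁴ - ℓ⁴ L₊ L₋`.
  have hx : x = 0 := by
    field_simp at h0 hr
    have : 2 * p.1 ^ 2 * x = 0 := by linear_combination h0 + hr
    simpa [hp] using this
  have hy : y = 0 := by
    subst hx
    field_simp at h0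
    have : ℓ ^ 2 * y = 0 := by linear_combination -h0
    simpa [hℓ] using this
  have ha' : p.1 ^ 2 * w = ℓ ^ 2 * Lp p.2.1 * z := by
    field_simp at ha; linear_combination ha
  have hb' : p.1 ^ 2 * z = ℓ ^ 2 * Lm p.2.2 * w := by
    field_simp at hb; linear_combination hb
  have hD : p.1 ^ 4 - ℓ ^ 4 * Lp p.2.1 * Lm p.2.2 ≠ 0 := sub_ne_zero.2 hdet.symm
  have hw : w = 0 := by
    have : (p.1 ^ 4 - ℓ ^ 4 * Lp p.2.1 * Lm p.2.2) * w = 0 := by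
      linear_combination p.1 ^ 2 * ha' + ℓ ^ 2 * Lp p.2.1 * hb'
    exact (mul_eq_zero.1 this).resolve_left hD
  have hz : z = 0 := by
    have : (p.1 ^ 4 - ℓ ^ 4 * Lp p.2.1 * Lm p.2.2) * z = 0 := by
      linear_combination p.1 ^ 2 * hb' + ℓ ^ 2 * Lm p.2.2 * ha'
    exact (mul_eq_zero.1 this).resolve_left hD
  simp [hx, hy, hz, hw]

/-- Pull-backs of the Bañados metric are computed from the embedding. -/
theorem pullbackTensor_eq_polar (hP : IsHillBasis Lp cp sp) (hM : IsHillBasis Lm cm sm)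
    {Φ : Coord → Coord} {p : Coord} (hΦ : DifferentiableAt ℝ Φ p) (hp : (Φ p).1 ≠ 0) (v w : Coord) :
    pullbackTensor Φ (banadosMetric ℓ Lp Lm) p v w =
      polar (fderiv ℝ (hillEmbedding ℓ cp sp cm sm ∘ Φ) p v)
        (fderiv ℝ (hillEmbedding ℓ cp sp cm sm ∘ Φ) p w) := by
  have hd : DifferentiableAt ℝ (hillEmbedding ℓ cp sp cm sm) (Φ p) :=
    (contDiffAt_hillEmbedding hP.smooth_fst hP.smooth_snd hM.smooth_fst hM.smooth_snd
      hp).differentiableAt (by simp)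
  rw [pullbackTensor, banadosMetric_eq_polar hP hM hp, fderiv_comp p hd hΦ]
  rfl

/-- Two embeddings that agree near a point induce the same metric there. Both the rigidity and the
existence part identify the pulled-back metric in this way. -/
theorem pullbackTensor_eq_of_eventuallyEq (hP : IsHillBasis Lp cp sp) (hM : IsHillBasis Lm cm sm)
    {Lp' Lm' dp ep dm em : ℝ → ℝ} (hP' : IsHillBasis Lp' dp ep) (hM' : IsHillBasis Lm' dm em)
    {Φ : Coord → Coord} {p : Coord} (hΦ : DifferentiableAt ℝ Φ p) (hp : (Φ p).1 ≠ 0) (hp0 : p.1 ≠ 0)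
    (h : hillEmbedding ℓ cp sp cm sm ∘ Φ =ᶠ[𝓝 p] hillEmbedding ℓ dp ep dm em) (v w : Coord) :
    pullbackTensor Φ (banadosMetric ℓ Lp Lm) p v w = banadosMetric ℓ Lp' Lm' p v w := by
  rw [pullbackTensor_eq_polar hP hM hΦ hp, banadosMetric_eq_polar hP' hM' hp0, h.fderiv_eq]

/-- The Bañados metric is nondegenerate where `r⁴ ≠ ℓ⁴ L₊ L₋`. -/
theorem eq_zero_of_banadosMetric (hℓ : ℓ ≠ 0) {p : Coord} (hp : p.1 ≠ 0)
    (hdet : ℓ ^ 4 * Lp p.2.1 * Lm p.2.2 ≠ p.1 ^ 4) {v : Coord}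
    (hv : ∀ w, banadosMetric ℓ Lp Lm p v w = 0) : v = 0 := by
  obtain ⟨r, a, b⟩ := p
  obtain ⟨x, y, z⟩ := v
  have h1 := hv (1, 0, 0)
  have h2 := hv (0, 1, 0)
  have h3 := hv (0, 0, 1)
  simp only [banadosMetric] at h1 h2 h3 hp hdet
  have hx : x = 0 := by
    field_simp at h1
    simpa [hℓ] using h1
  set α := r * y - ℓ ^ 2 * Lm b * z / r with hα
  set β := r * z - ℓ ^ 2 * Lp a * y / r with hβ
  have hD : r ^ 4 - ℓ ^ 4 * Lp a * Lm b ≠ 0 := sub_ne_zero.2 hdet.symm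
  have h2' : r ^ 2 * β = ℓ ^ 2 * Lp a * α := by
    clear_value α β
    simp only [mul_zero, mul_one, zero_div, sub_zero, zero_sub] at h2
    field_simp at h2
    linear_combination -h2
  have h3' : r ^ 2 * α = ℓ ^ 2 * Lm b * β := by
    clear_value α β
    simp only [mul_zero, mul_one, zero_div, sub_zero, zero_sub] at h3
    field_simp at h3
    linear_combination -h3
  -- The same nondegenerate `2 × 2` system occurs twice: for the values of the two one-forms on `v`,
  -- then for the components of `v`.
  have solve : ∀ {m n i j : ℝ}, r ^ 2 * m = ℓ ^ 2 * i * n → r ^ 2 * n = ℓ ^ 2 * j * m →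
      i * j = Lp a * Lm b → m = 0 := by
    intro m n i j e1 e2 e3
    have : (r ^ 4 - ℓ ^ 4 * Lp a * Lm b) * m = 0 := by
      linear_combination r ^ 2 * e1 + ℓ ^ 2 * i * e2 + ℓ ^ 4 * m * e3
    exact (mul_eq_zero.1 this).resolve_left hD
  have hβ0 : β = 0 := solve h2' h3' rfl
  have hα0 : α = 0 := solve h3' h2' (mul_comm _ _)
  have e1 : r ^ 2 * y = ℓ ^ 2 * Lm b * z := by
    rw [hα] at hα0
    field_simp at hα0
    linear_combination hα0
  have e2 : r ^ 2 * z = ℓ ^ 2 * Lp a * y := by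
    rw [hβ] at hβ0
    field_simp at hβ0
    linear_combination hβ0
  rw [hx, solve e1 e2 (mul_comm _ _), solve e2 e1 rfl]
  rfl

end

/-! ### Radial curves of a Fefferman–Graham gauge -/

theorem isOpen_nearBoundary (ρ : ℝ) : IsOpen (nearBoundary ρ) :=
  isOpen_lt continuous_const continuous_fst

section

variable {F : Type*} [NormedAddCommGroup F] [NormedSpace ℝ F]

theorem contDiffAt_fderiv_apply {y : Coord → F} {p : Coord} (hy : ContDiffAt ℝ ∞ y p) (v : Coord) :
    ContDiffAt ℝ ∞ (fun q => fderiv ℝ y q v) p :=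
  (hy.fderiv_right (m := ∞) (by simp)).clm_apply contDiffAt_const

theorem fderiv_fderiv_apply_comm {y : Coord → F} {p : Coord} (hy : ContDiffAt ℝ ∞ y p)
    (v w : Coord) :
    fderiv ℝ (fun q => fderiv ℝ y q v) p w = fderiv ℝ (fun q => fderiv ℝ y q w) p v := by
  have hd : DifferentiableAt ℝ (fderiv ℝ y) p :=
    (hy.fderiv_right (m := ∞) (by simp)).differentiableAt (by simp)
  have key : ∀ v w : Coord, fderiv ℝ (fun q => fderiv ℝ y q v) p w =
      fderiv ℝ (fderiv ℝ y) p w v := fun v w => by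
    rw [fderiv_clm_apply hd (differentiableAt_const v)]
    simp
  rw [key, key]
  exact (hy.isSymmSndFDerivAt (by simp; exact WithTop.coe_le_coe.2 (le_top : (2 : ℕ∞) ≤ ⊤))).eq w v

theorem hasDerivAt_radial {y : Coord → F} {r a b : ℝ} (hy : DifferentiableAt ℝ y (r, a, b)) :
    HasDerivAt (fun r => y (r, a, b)) (fderiv ℝ y (r, a, b) (1, 0, 0)) r :=
  hy.hasFDerivAt.comp_hasDerivAt r ((hasDerivAt_id r).prodMk (hasDerivAt_const r (a, b)))

theorem hasDerivAt_plus {y : Coord → F} {r a b : ℝ} (hy : DifferentiableAt ℝ y (r, a, b)) :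
    HasDerivAt (fun a => y (r, a, b)) (fderiv ℝ y (r, a, b) (0, 1, 0)) a :=
  hy.hasFDerivAt.comp_hasDerivAt a
    ((hasDerivAt_const a r).prodMk ((hasDerivAt_id a).prodMk (hasDerivAt_const a b)))

theorem hasDerivAt_minus {y : Coord → F} {r a b : ℝ} (hy : DifferentiableAt ℝ y (r, a, b)) :
    HasDerivAt (fun b => y (r, a, b)) (fderiv ℝ y (r, a, b) (0, 0, 1)) b :=
  hy.hasFDerivAt.comp_hasDerivAt b
    ((hasDerivAt_const b r).prodMk ((hasDerivAt_const b a).prodMk (hasDerivAt_id b)))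

/-- Solutions of `r² y'' + r y' - y = 0` are combinations of `r` and `1 / r`. -/
theorem exists_radial_solution {γ η : ℝ → F} {ρ : ℝ} (hρ : 0 ≤ ρ)
    (hγ : ∀ r, ρ < r → HasDerivAt γ (η r) r)
    (hη : ∀ r, ρ < r → HasDerivAt η ((1 / r ^ 2) • γ r - (1 / r) • η r) r) :
    ∃ A B : F, ∀ r, ρ < r → γ r = r • A + (1 / r) • B ∧ η r = A - (1 / r ^ 2) • B := by
  -- Solving `γ = r A + B/r`, `η = A - B/r²` for `A` and `B` gives two first integrals.
  have hA : ∀ r, ρ < r → HasDerivAt (fun r => (1 / 2 : ℝ) • ((1 / r) • γ r + η r)) 0 r := by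
    intro r hr
    have hr0 : r ≠ 0 := (hρ.trans_lt hr).ne'
    have h1 : HasDerivAt (fun r : ℝ => 1 / r) (-(1 / r ^ 2)) r := by
      simpa [one_div] using hasDerivAt_inv hr0
    refine (((h1.smul (hγ r hr)).add (hη r hr)).const_smul (1 / 2 : ℝ)).congr_deriv ?_
    module
  have hB : ∀ r, ρ < r → HasDerivAt (fun r => (1 / 2 : ℝ) • (r • γ r - r ^ 2 • η r)) 0 r := by
    intro r hr
    have hr0 : r ≠ 0 := (hρ.trans_lt hr).ne'
    refine (((hasDerivAt_id r).smul (hγ r hr)).sub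
      ((hasDerivAt_pow 2 r).smul (hη r hr)) |>.const_smul (1 / 2 : ℝ)).congr_deriv ?_
    simp only [id]
    match_scalars
    · field_simp; ring
    · field_simp; ring
  have hconst : ∀ f : ℝ → F, (∀ r, ρ < r → HasDerivAt f 0 r) → ∀ r, ρ < r → f r = f (ρ + 1) := by
    intro f hf r hr
    refine (isOpen_Ioi (a := ρ)).is_const_of_deriv_eq_zero isPreconnected_Ioi
      (fun x hx => (hf x hx).differentiableAt.differentiableWithinAt)
      (fun x hx => (hf x hx).deriv) hr (by simp)
  refine ⟨(1 / 2 : ℝ) • ((1 / (ρ + 1)) • γ (ρ + 1) + η (ρ + 1)),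
    (1 / 2 : ℝ) • ((ρ + 1) • γ (ρ + 1) - (ρ + 1) ^ 2 • η (ρ + 1)), fun r hr => ?_⟩
  have hr0 : r ≠ 0 := (hρ.trans_lt hr).ne'
  rw [← hconst _ hA r hr, ← hconst _ hB r hr]
  constructor
  · match_scalars
    · field_simp; ring
    · field_simp; ring
  · match_scalars
    · field_simp; ring
    · field_simp; ring

end

/-- In Fefferman–Graham gauge, the radial acceleration is orthogonal to the quadric up to the
terms of the radial equation. -/
theorem polar_radial_equation {ℓ : ℝ} {U : Set Coord} (hU : IsOpen U) {y : Coord → Quad}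
    (hy : ∀ p ∈ U, ContDiffAt ℝ ∞ y p) (hU0 : ∀ p ∈ U, p.1 ≠ 0)
    (hdet : ∀ p ∈ U, polar (y p) (y p) = -ℓ ^ 2)
    (hrr : ∀ p ∈ U, polar (fderiv ℝ y p (1, 0, 0)) (fderiv ℝ y p (1, 0, 0)) = ℓ ^ 2 / p.1 ^ 2)
    (hrp : ∀ p ∈ U, polar (fderiv ℝ y p (1, 0, 0)) (fderiv ℝ y p (0, 1, 0)) = 0)
    (hrm : ∀ p ∈ U, polar (fderiv ℝ y p (1, 0, 0)) (fderiv ℝ y p (0, 0, 1)) = 0)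
    {p : Coord} (hp : p ∈ U) {K : Quad}
    (hK : K = fderiv ℝ (fun q => fderiv ℝ y q (1, 0, 0)) p (1, 0, 0) -
      ((1 / p.1 ^ 2) • y p - (1 / p.1) • fderiv ℝ y p (1, 0, 0))) :
    polar K (y p) = 0 ∧ ∀ v, polar K (fderiv ℝ y p v) = 0 := by
  have hp0 := hU0 p hp
  have hev : ∀ {f : Coord → ℝ} {g : Coord → ℝ}, (∀ q ∈ U, f q = g q) →
      fderiv ℝ f p = fderiv ℝ g p := fun h =>
    Filter.EventuallyEq.fderiv_eq (by filter_upwards [hU.mem_nhds hp] with q hq using h q hq)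
  have dy : ∀ q ∈ U, DifferentiableAt ℝ y q := fun q hq => (hy q hq).differentiableAt (by simp)
  have dD : ∀ v, DifferentiableAt ℝ (fun q => fderiv ℝ y q v) p := fun v =>
    (contDiffAt_fderiv_apply (hy p hp) v).differentiableAt (by simp)
  have hyD : ∀ q ∈ U, ∀ v, polar (y q) (fderiv ℝ y q v) = 0 := by
    intro q hq v
    have h1 := fderiv_polar_apply (dy q hq) (dy q hq) v
    have h2 : fderiv ℝ (fun q => polar (y q) (y q)) q = fderiv ℝ (fun _ => -ℓ ^ 2) q :=
      Filter.EventuallyEq.fderiv_eq (by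
        filter_upwards [hU.mem_nhds hq] with q hq using hdet q hq)
    rw [h2, polar_comm (fderiv ℝ y q v)] at h1
    simp only [fderiv_fun_const, Pi.zero_apply, _root_.zero_apply] at h1
    linarith
  -- the second derivative against the position
  have hb0 : polar (fderiv ℝ (fun q => fderiv ℝ y q (1, 0, 0)) p (1, 0, 0)) (y p) =
      -(ℓ ^ 2 / p.1 ^ 2) := by
    have h1 := fderiv_polar_apply (dy p hp) (dD (1, 0, 0)) (1, 0, 0)
    rw [hev (g := fun _ => 0) (fun q hq => hyD q hq (1, 0, 0)), hrr p hp, polar_comm (y p)] at h1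
    simp only [fderiv_fun_const, Pi.zero_apply, _root_.zero_apply] at h1
    linarith
  -- derivatives of the squared length of the radial vector
  have hsq : ∀ v : Coord, polar (fderiv ℝ (fun q => fderiv ℝ y q (1, 0, 0)) p v)
      (fderiv ℝ y p (1, 0, 0)) = -(ℓ ^ 2 / p.1 ^ 3) * v.1 := by
    intro v
    have h1 := fderiv_polar_apply (dD (1, 0, 0)) (dD (1, 0, 0)) v
    have h2 : HasFDerivAt (fun q : Coord => ℓ ^ 2 / q.1 ^ 2)
        ((-(2 * ℓ ^ 2 / p.1 ^ 3)) • ContinuousLinearMap.fst ℝ ℝ (ℝ × ℝ)) p := by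
      have h3 : HasDerivAt (fun r : ℝ => ℓ ^ 2 / r ^ 2) (-(2 * ℓ ^ 2 / p.1 ^ 3)) p.1 := by
        refine ((hasDerivAt_const p.1 (ℓ ^ 2)).div (hasDerivAt_pow 2 p.1)
          (pow_ne_zero 2 hp0)).congr_deriv ?_
        field_simp
        ring
      exact h3.comp_hasFDerivAt p hasFDerivAt_fst
    rw [hev hrr, h2.fderiv, polar_comm (fderiv ℝ y p (1, 0, 0))] at h1
    simp only [_root_.smul_apply, ContinuousLinearMap.coe_fst', smul_eq_mul] at h1
    have e : (-(ℓ ^ 2 / p.1 ^ 3) * v.1) = -(2 * ℓ ^ 2 / p.1 ^ 3) * v.1 / 2 := by ring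
    rw [e]
    linarith
  -- Differentiating `g_{rv} = 0` radially and exchanging mixed derivatives gives `⟨∂ᵣ²y, ∂ᵥy⟩ = -½
  -- ∂ᵥ g_{rr}`, which vanishes because `g_{rr}` depends on `r` alone.
  have hb : ∀ v : Coord, v.1 = 0 →
      (∀ q ∈ U, polar (fderiv ℝ y q (1, 0, 0)) (fderiv ℝ y q v) = 0) →
      polar (fderiv ℝ (fun q => fderiv ℝ y q (1, 0, 0)) p (1, 0, 0)) (fderiv ℝ y p v) = 0 := by
    intro v hv h
    have h1 := fderiv_polar_apply (dD (1, 0, 0)) (dD v) (1, 0, 0)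
    rw [hev (g := fun _ => 0) h, fderiv_fderiv_apply_comm (hy p hp) v, polar_comm _ (fderiv ℝ
      (fun q => fderiv ℝ y q (1, 0, 0)) p v), hsq v, hv] at h1
    simp only [fderiv_fun_const, Pi.zero_apply, _root_.zero_apply] at h1
    linarith
  have hKp : polar K (fderiv ℝ y p (0, 1, 0)) = 0 := by
    rw [hK, polar_sub_left, polar_sub_left, polar_smul_left, polar_smul_left, hyD p hp, hrp p hp,
      hb _ rfl hrp]
    ring
  have hKm : polar K (fderiv ℝ y p (0, 0, 1)) = 0 := by
    rw [hK, polar_sub_left, polar_sub_left, polar_smul_left, polar_smul_left, hyD p hp, hrm p hp,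
      hb _ rfl hrm]
    ring
  have hKr : polar K (fderiv ℝ y p (1, 0, 0)) = 0 := by
    rw [hK, polar_sub_left, polar_sub_left, polar_smul_left, polar_smul_left, hyD p hp, hrr p hp,
      hsq]
    field_simp
    ring
  refine ⟨?_, fun v => ?_⟩
  · rw [hK, polar_sub_left, polar_sub_left, polar_smul_left, polar_smul_left, hdet p hp,
      polar_comm _ (y p), polar_comm _ (y p), hyD p hp, polar_comm (y p), hb0]
    field_simp
    ring
  · have hv : v = v.1 • ((1, 0, 0) : Coord) + v.2.1 • ((0, 1, 0) : Coord) +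
        v.2.2 • ((0, 0, 1) : Coord) := by ext <;> simp
    rw [hv, map_add, map_add, map_smul, map_smul, map_smul, polar_add_right, polar_add_right,
      polar_smul_right, polar_smul_right, polar_smul_right, hKr, hKp, hKm]
    ring

section

variable {ℓ ρ : ℝ} {Lp Lm hp hm cp sp cm sm : ℝ → ℝ} {Φ : Coord → Coord}

namespace IsFGDiffeo

variable (hΦ : IsFGDiffeo ℓ Lp Lm hp hm ρ Φ)
include hΦ

theorem contDiffAt {p : Coord} (hp' : p ∈ nearBoundary ρ) : ContDiffAt ℝ ∞ Φ p :=
  hΦ.smooth.contDiffAt ((isOpen_nearBoundary ρ).mem_nhds hp')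

theorem contDiffAt_comp (hP : IsHillBasis Lp cp sp) (hM : IsHillBasis Lm cm sm) {p : Coord}
    (hp' : p ∈ nearBoundary ρ) : ContDiffAt ℝ ∞ (hillEmbedding ℓ cp sp cm sm ∘ Φ) p :=
  (contDiffAt_hillEmbedding hP.smooth_fst hP.smooth_snd hM.smooth_fst hM.smooth_snd
    (hΦ.mapsTo hp').1.ne').comp p (hΦ.contDiffAt hp')

theorem polar_fderiv_comp (hP : IsHillBasis Lp cp sp) (hM : IsHillBasis Lm cm sm) {p : Coord}
    (hp' : p ∈ nearBoundary ρ) (v w : Coord) :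
    polar (fderiv ℝ (hillEmbedding ℓ cp sp cm sm ∘ Φ) p v)
      (fderiv ℝ (hillEmbedding ℓ cp sp cm sm ∘ Φ) p w) =
        pullbackTensor Φ (banadosMetric ℓ Lp Lm) p v w :=
  (pullbackTensor_eq_polar hP hM ((hΦ.contDiffAt hp').differentiableAt (by simp))
    (hΦ.mapsTo hp').1.ne' v w).symm

/-- Along radial curves the embedding of a Fefferman–Graham diffeomorphism is a combination of `r`
and `1 / r`. -/
theorem exists_radial_coefficients (hℓ : 0 < ℓ) (hρ : 0 ≤ ρ) (hP : IsHillBasis Lp cp sp)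
    (hM : IsHillBasis Lm cm sm) (a b : ℝ) :
    ∃ A B : Quad, ∀ r, ρ < r →
      hillEmbedding ℓ cp sp cm sm (Φ (r, a, b)) = r • A + (1 / r) • B ∧
      fderiv ℝ (hillEmbedding ℓ cp sp cm sm ∘ Φ) (r, a, b) (1, 0, 0) = A - (1 / r ^ 2) • B := by
  set y := hillEmbedding ℓ cp sp cm sm ∘ Φ with hy
  have hys : ∀ p ∈ nearBoundary ρ, ContDiffAt ℝ ∞ y p := fun p hp' => hΦ.contDiffAt_comp hP hM hp'
  have hd : ∀ p ∈ nearBoundary ρ, DifferentiableAt ℝ y p :=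
    fun p hp' => (hys p hp').differentiableAt (by simp)
  refine exists_radial_solution (γ := fun r => y (r, a, b)) hρ
    (fun r hr => hasDerivAt_radial (hd (r, a, b) hr)) (fun r hr => ?_)
  have hmem : (r, a, b) ∈ nearBoundary ρ := hr
  have h1 := hasDerivAt_radial (y := fun q => fderiv ℝ y q (1, 0, 0)) (r := r) (a := a) (b := b)
    ((contDiffAt_fderiv_apply (hys _ hmem) _).differentiableAt (by simp))
  refine h1.congr_deriv (sub_eq_zero.1 ?_)
  have hpos := hΦ.mapsTo hmem
  obtain ⟨k0, k1⟩ := polar_radial_equation (ℓ := ℓ) (isOpen_nearBoundary ρ) hys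
    (fun p hp' => (hρ.trans_lt hp').ne')
    (fun p hp' => polar_hillEmbedding_self hP hM (hΦ.mapsTo hp').1.ne')
    (fun p hp' => by rw [hΦ.polar_fderiv_comp hP hM hp']; exact (hΦ.gauge p hp').1)
    (fun p hp' => by rw [hΦ.polar_fderiv_comp hP hM hp']; exact (hΦ.gauge p hp').2.1)
    (fun p hp' => by rw [hΦ.polar_fderiv_comp hP hM hp']; exact (hΦ.gauge p hp').2.2) hmem rfl
  -- Orthogonality is known for tangent vectors of `y ∘ Φ`; surjectivity of the derivative of `Φ`
  -- extends it to all tangent vectors of the embedding, which is an immersion on the patch.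
  refine eq_zero_of_polar_hillEmbedding hℓ.ne' hP hM hpos.1.ne' hpos.2.ne k0 fun v => ?_
  obtain ⟨w, rfl⟩ := (hΦ.bijective_fderiv _ hmem).2 v
  have e : fderiv ℝ y (r, a, b) w =
      fderiv ℝ (hillEmbedding ℓ cp sp cm sm) (Φ (r, a, b)) (fderiv ℝ Φ (r, a, b) w) := by
    rw [hy, fderiv_comp _ ((contDiffAt_hillEmbedding hP.smooth_fst hP.smooth_snd hM.smooth_fst
      hM.smooth_snd hpos.1.ne').differentiableAt (by simp))
      ((hΦ.contDiffAt hmem).differentiableAt (by simp))]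
    rfl
  rw [← e]
  exact k1 w

end IsFGDiffeo

end

/-! ### Rigidity: the embedding of a Fefferman–Graham diffeomorphism -/

theorem dyad_mul (x y a b c d : ℝ) : dyad (x * a) (x * b) (y * c) (y * d) = (x * y) • dyad a b c d := by
  ext <;> simp only [dyad, Prod.smul_fst, Prod.smul_snd, smul_eq_mul] <;> ring

theorem tendsto_dyad {α : Type*} {l : Filter α} {f g h k : α → ℝ} {a b c d : ℝ}
    (hf : Tendsto f l (𝓝 a)) (hg : Tendsto g l (𝓝 b)) (hh : Tendsto h l (𝓝 c))
    (hk : Tendsto k l (𝓝 d)) :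
    Tendsto (fun x => dyad (f x) (g x) (h x) (k x)) l (𝓝 (dyad a b c d)) :=
  (hf.mul hh).prodMk_nhds ((hf.mul hk).prodMk_nhds ((hg.mul hh).prodMk_nhds (hg.mul hk)))

theorem hasDerivAt_dyad_left {f g : ℝ → ℝ} {f' g' x : ℝ} (c d : ℝ) (hf : HasDerivAt f f' x)
    (hg : HasDerivAt g g' x) : HasDerivAt (fun x => dyad (f x) (g x) c d) (dyad f' g' c d) x :=
  (hf.mul_const c).prodMk ((hf.mul_const d).prodMk ((hg.mul_const c).prodMk (hg.mul_const d)))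

theorem hasDerivAt_dyad_right {f g : ℝ → ℝ} {f' g' x : ℝ} (a b : ℝ) (hf : HasDerivAt f f' x)
    (hg : HasDerivAt g g' x) : HasDerivAt (fun x => dyad a b (f x) (g x)) (dyad a b f' g') x :=
  (hf.const_mul a).prodMk ((hg.const_mul a).prodMk ((hf.const_mul b).prodMk (hg.const_mul b)))

/-- The prescribed limit of `R/r` splits into the weights of the two Hill transforms; this is why
the leading coefficient is a dyad of transformed frames. -/
theorem one_div_sqrt_mul_deriv {hp hm : ℝ → ℝ} (hhp : IsBoundaryMap hp) (hhm : IsBoundaryMap hm)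
    (a b : ℝ) : 1 / √(deriv hp a * deriv hm b) =
      Real.exp (-(logDerivative hp a) / 2) * Real.exp (-(logDerivative hm b) / 2) := by
  rw [Real.sqrt_mul (hhp.deriv_pos a).le, hhp.deriv_eq_exp_mul_exp, hhm.deriv_eq_exp_mul_exp,
    Real.sqrt_mul_self (Real.exp_pos _).le, Real.sqrt_mul_self (Real.exp_pos _).le,
    neg_div, neg_div, Real.exp_neg, Real.exp_neg, one_div, mul_inv]

/-- The subleading radial coefficient is determined by the leading one, through the orthogonality
relations of the Fefferman–Graham gauge. -/
theorem eq_smul_dyad_of_polar {ℓ a b a' b' c d c' d' : ℝ} (hℓ : ℓ ≠ 0) (h₁ : a * b' - a' * b = 1)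
    (h₂ : c * d' - c' * d = 1) {B : Quad} (h0 : 2 * polar B (dyad a b c d) = -ℓ ^ 2)
    (hp : polar B (dyad a' b' c d) = 0) (hm : polar B (dyad a b c' d') = 0) (hB : polar B B = 0) :
    B = (-ℓ ^ 2) • dyad a' b' c' d' := by
  have h := quad_expansion h₁ h₂ B
  -- The last coefficient comes from pairing `B` with its own expansion: `B` is null and its pairing
  -- with the first dyad is nonzero.
  have hx : polar B (dyad a' b' c' d') = 0 := by
    have h3 := congrArg (polar B) h
    rw [polar_add_right, polar_sub_right, polar_sub_right, polar_smul_right, polar_smul_right,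
      polar_smul_right, polar_smul_right, hB, hp, hm, h0] at h3
    have h4 : polar B (dyad a b c d) = -ℓ ^ 2 / 2 := by linarith
    rw [h4] at h3
    have h5 : ℓ ^ 2 * polar B (dyad a' b' c' d') = 0 := by linear_combination h3 / 2
    simpa [hℓ] using h5
  rw [h, hx, hp, hm, h0]
  simp

section

variable {ℓ ρ : ℝ} {Lp Lm hp hm cp sp cm sm : ℝ → ℝ} {Φ : Coord → Coord}

namespace IsFGDiffeo

variable (hΦ : IsFGDiffeo ℓ Lp Lm hp hm ρ Φ)
include hΦ

/-- After division by `r` the leading term is `R/r` times a dyad at `(X⁺, X⁻)`, and the other one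
carries the factor `ℓ²/(rR)`, which tends to `0`. The limit identifies the coefficient `A`. -/
theorem tendsto_hillEmbedding (hhp : IsBoundaryMap hp) (hhm : IsBoundaryMap hm)
    (hP : IsHillBasis Lp cp sp) (hM : IsHillBasis Lm cm sm) (a b : ℝ) :
    Tendsto (fun r : ℝ => (1 / r) • hillEmbedding ℓ cp sp cm sm (Φ (r, a, b))) atTop
      (𝓝 (dyad (hillTransform cp hp a) (hillTransform sp hp a) (hillTransform cm hm b)
        (hillTransform sm hm b))) := by
  have hX := hΦ.tendsto_plus a b
  have hY := hΦ.tendsto_minus a b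
  have hR := hΦ.tendsto_radial a b
  rw [one_div_sqrt_mul_deriv hhp hhm] at hR
  have hcomp : ∀ {u : ℝ → ℝ} {z : ℝ} {f : ℝ → ℝ}, ContDiff ℝ ∞ u → Tendsto f atTop (𝓝 z) →
      Tendsto (fun r => u (f r)) atTop (𝓝 (u z)) := fun hu hf =>
    (hu.continuous.tendsto _).comp hf
  have h1 := hR.smul (tendsto_dyad (hcomp hP.smooth_fst hX) (hcomp hP.smooth_snd hX)
    (hcomp hM.smooth_fst hY) (hcomp hM.smooth_snd hY))
  have hinv : Tendsto (fun r : ℝ => ℓ ^ 2 / (r ^ 2 * ((Φ (r, a, b)).1 / r))) atTop (𝓝 0) :=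
    tendsto_const_nhds.div_atTop ((tendsto_pow_atTop two_ne_zero).atTop_mul_pos
      (mul_pos (Real.exp_pos _) (Real.exp_pos _)) hR)
  have h2 := hinv.smul (tendsto_dyad (hcomp (contDiff_deriv hP.smooth_fst) hX)
    (hcomp (contDiff_deriv hP.smooth_snd) hX)
    (hcomp (contDiff_deriv hM.smooth_fst) hY) (hcomp (contDiff_deriv hM.smooth_snd) hY))
  have h3 := h1.sub h2
  rw [zero_smul, sub_zero, ← dyad_mul] at h3
  refine h3.congr' ?_
  filter_upwards [eventually_gt_atTop 0, eventually_gt_atTop ρ] with r hr hrρ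
  have hpos : (Φ (r, a, b)).1 ≠ 0 := (hΦ.mapsTo (show (r, a, b) ∈ nearBoundary ρ from hrρ)).1.ne'
  rw [hillEmbedding]
  match_scalars
  · field_simp
  · field_simp

/-- The rigidity statement. `A` is fixed by the asymptotics, and `B` by the four relations `⟨B, B⟩ =
0`, `2⟨B, A⟩ = -ℓ²`, `⟨B, ∂±A⟩ = 0`. -/
theorem hillEmbedding_comp (hℓ : 0 < ℓ) (hρ : 0 ≤ ρ) (hhp : IsBoundaryMap hp)
    (hhm : IsBoundaryMap hm) (hP : IsHillBasis Lp cp sp) (hM : IsHillBasis Lm cm sm)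
    {p : Coord} (hp' : p ∈ nearBoundary ρ) :
    hillEmbedding ℓ cp sp cm sm (Φ p) = hillEmbedding ℓ (hillTransform cp hp)
      (hillTransform sp hp) (hillTransform cm hm) (hillTransform sm hm) p := by
  have hP' := hhp.isHillBasis_hillTransform hP
  have hM' := hhm.isHillBasis_hillTransform hM
  choose A B hAB using hΦ.exists_radial_coefficients hℓ hρ hP hM
  have hA : ∀ a b, A a b = dyad (hillTransform cp hp a) (hillTransform sp hp a)
      (hillTransform cm hm b) (hillTransform sm hm b) := by
    intro a b
    refine tendsto_nhds_unique ?_ (hΦ.tendsto_hillEmbedding hhp hhm hP hM a b)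
    have h1 : Tendsto (fun r : ℝ => (1 / r ^ 2) • B a b) atTop (𝓝 ((0 : ℝ) • B a b)) :=
      (tendsto_const_nhds.div_atTop (tendsto_pow_atTop two_ne_zero)).smul_const _
    have h2 := h1.const_add (A a b)
    rw [zero_smul, add_zero] at h2
    refine h2.congr' ?_
    filter_upwards [eventually_gt_atTop 0, eventually_gt_atTop ρ] with r hr hrρ
    rw [(hAB a b r hrρ).1]
    match_scalars
    · field_simp
    · field_simp
  set y := hillEmbedding ℓ cp sp cm sm ∘ Φ with hy
  have hyd : ∀ a b r, ρ < r → DifferentiableAt ℝ y (r, a, b) := fun a b r hr =>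
    (hΦ.contDiffAt_comp hP hM (show (r, a, b) ∈ nearBoundary ρ from hr)).differentiableAt (by simp)
  have hAA : ∀ a b, polar (A a b) (A a b) = 0 := fun a b => by
    rw [hA, polar_dyad]; ring
  have hdet : ∀ a b r, ρ < r → 2 * polar (B a b) (A a b) + 1 / r ^ 2 * polar (B a b) (B a b) =
      -ℓ ^ 2 := by
    intro a b r hr
    have hr0 : r ≠ 0 := (hρ.trans_lt hr).ne'
    rw [← polar_hillEmbedding_self (ℓ := ℓ) hP hM (hΦ.mapsTo
      (show (r, a, b) ∈ nearBoundary ρ from hr)).1.ne', (hAB a b r hr).1]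
    simp only [polar_add_left, polar_add_right, polar_smul_left, polar_smul_right, hAA,
      polar_comm (A a b) (B a b)]
    field_simp
    ring
  set r₀ := ρ + 1 with hr₀
  have hr₀ρ : ρ < r₀ := by linarith
  have hr₀0 : 0 < r₀ := by linarith
  -- Comparing the determinant condition at two radii isolates its `1/r²` term.
  have hBB : ∀ a b, polar (B a b) (B a b) = 0 := by
    intro a b
    have h1 := hdet a b r₀ hr₀ρ
    have h2 := hdet a b (2 * r₀) (by linarith)
    have h3 : 1 / r₀ ^ 2 * polar (B a b) (B a b) =
        1 / (2 * r₀) ^ 2 * polar (B a b) (B a b) := by linarith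
    field_simp at h3
    linarith
  have hBA : ∀ a b, 2 * polar (B a b) (A a b) = -ℓ ^ 2 := by
    intro a b
    have h1 := hdet a b r₀ hr₀ρ
    rw [hBB, mul_zero, add_zero] at h1
    exact h1
  -- orthogonality of the subleading coefficient to the tangential derivatives of the leading one
  have orth : ∀ (α β : ℝ → Quad) (α' y' : Quad) (x : ℝ), (∀ t, polar (α t) (α t) = 0) →
      (∀ t, polar (β t) (β t) = 0) → (∀ t, 2 * polar (β t) (α t) = -ℓ ^ 2) →
      HasDerivAt α α' x → HasDerivAt (fun t => r₀ • α t + (1 / r₀) • β t) y' x →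
      polar (α x - (1 / r₀ ^ 2) • β x) y' = 0 → polar (β x) α' = 0 := by
    intro α β α' y' x h1 h2 h3 hα hy' h4
    -- Nothing is known a priori about the regularity of the subleading coefficient; it is recovered
    -- from `y` at the single radius `r₀` and from the explicit leading coefficient.
    have hβ : HasDerivAt β (r₀ • (y' - r₀ • α')) x := by
      refine ((hy'.sub (hα.const_smul r₀)).const_smul r₀).congr_of_eventuallyEq
        (Eventually.of_forall fun t => ?_)
      simp only [Pi.smul_apply, Pi.sub_apply]
      match_scalars <;> field_simp
      ring
    have e1 := (hasDerivAt_polar hα hα).unique (by rw [funext h1]; exact hasDerivAt_const x 0)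
    have e2 := (hasDerivAt_polar hβ hβ).unique (by rw [funext h2]; exact hasDerivAt_const x 0)
    have e3 := (hasDerivAt_polar hβ hα).unique (by
      have : (fun t => polar (β t) (α t)) = fun _ => -ℓ ^ 2 / 2 := funext fun t => by
        linarith [h3 t]
      rw [this]; exact hasDerivAt_const x _)
    rw [polar_comm α'] at e1
    rw [polar_comm _ (β x)] at e2
    rw [polar_comm _ (α x)] at e3
    simp only [polar_smul_right, polar_sub_right, polar_sub_left, polar_smul_left] at e1 e2 e3 h4
    have e2' : polar (β x) y' = r₀ * polar (β x) α' := by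
      have : r₀ * (polar (β x) y' - r₀ * polar (β x) α') = 0 := by linarith
      have := (mul_eq_zero.1 this).resolve_left hr₀0.ne'
      linarith
    -- Constancy of `⟨β, α⟩` gives `⟨β, α'⟩ + ⟨α, β'⟩ = 0`, and the gauge condition gives `⟨α, β'⟩ -
    -- ⟨β, α'⟩ = 0`.
    have e1' : polar (α x) α' = 0 := by linarith
    rw [e1', mul_zero, sub_zero] at e3
    rw [e2'] at h4
    field_simp at h4
    have : 2 * polar (β x) α' = 0 := by linear_combination e3 - h4
    linarith
  have hBp : ∀ a b, polar (B a b) (dyad (deriv (hillTransform cp hp) a)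
      (deriv (hillTransform sp hp) a) (hillTransform cm hm b) (hillTransform sm hm b)) = 0 := by
    intro a b
    have hmem : (r₀, a, b) ∈ nearBoundary ρ := hr₀ρ
    refine orth (fun a => A a b) (fun a => B a b) _ (fderiv ℝ y (r₀, a, b) (0, 1, 0)) a
      (fun t => hAA t b) (fun t => hBB t b) (fun t => hBA t b) ?_ ?_ ?_
    · simp only [hA]
      exact hasDerivAt_dyad_left _ _ (hasDerivAt_of_contDiff hP'.smooth_fst a)
        (hasDerivAt_of_contDiff hP'.smooth_snd a)
    · exact (hasDerivAt_plus (hyd a b r₀ hr₀ρ)).congr_of_eventuallyEq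
        (Eventually.of_forall fun t => ((hAB t b r₀ hr₀ρ).1).symm)
    · rw [← (hAB a b r₀ hr₀ρ).2]
      exact (hΦ.polar_fderiv_comp hP hM hmem _ _).trans (hΦ.gauge _ hmem).2.1
  have hBm : ∀ a b, polar (B a b) (dyad (hillTransform cp hp a) (hillTransform sp hp a)
      (deriv (hillTransform cm hm) b) (deriv (hillTransform sm hm) b)) = 0 := by
    intro a b
    have hmem : (r₀, a, b) ∈ nearBoundary ρ := hr₀ρ
    refine orth (fun b => A a b) (fun b => B a b) _ (fderiv ℝ y (r₀, a, b) (0, 0, 1)) b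
      (fun t => hAA a t) (fun t => hBB a t) (fun t => hBA a t) ?_ ?_ ?_
    · simp only [hA]
      exact hasDerivAt_dyad_right _ _ (hasDerivAt_of_contDiff hM'.smooth_fst b)
        (hasDerivAt_of_contDiff hM'.smooth_snd b)
    · exact (hasDerivAt_minus (hyd a b r₀ hr₀ρ)).congr_of_eventuallyEq
        (Eventually.of_forall fun t => ((hAB a t r₀ hr₀ρ).1).symm)
    · rw [← (hAB a b r₀ hr₀ρ).2]
      exact (hΦ.polar_fderiv_comp hP hM hmem _ _).trans (hΦ.gauge _ hmem).2.2
  obtain ⟨r, a, b⟩ := p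
  have hr : ρ < r := hp'
  rw [(hAB a b r hr).1, hillEmbedding, hA a b, eq_smul_dyad_of_polar hℓ.ne' (hP'.wronskian a)
    (hM'.wronskian b) (by rw [← hA]; exact hBA a b) (hBp a b) (hBm a b) (hBB a b)]
  match_scalars <;> ring

/-- A Fefferman–Graham diffeomorphism maps the Bañados metric to the Bañados metric with the
transformed functions. -/
theorem pullbackTensor_eq (hℓ : 0 < ℓ) (hρ : 0 ≤ ρ) (hhp : IsBoundaryMap hp)
    (hhm : IsBoundaryMap hm) (hP : IsHillBasis Lp cp sp) (hM : IsHillBasis Lm cm sm)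
    {p : Coord} (hp' : p ∈ nearBoundary ρ) (v w : Coord) :
    pullbackTensor Φ (banadosMetric ℓ Lp Lm) p v w =
      banadosMetric ℓ (transformedL Lp hp) (transformedL Lm hm) p v w := by
  refine pullbackTensor_eq_of_eventuallyEq hP hM (hhp.isHillBasis_hillTransform hP)
    (hhm.isHillBasis_hillTransform hM) ((hΦ.contDiffAt hp').differentiableAt (by simp))
    (hΦ.mapsTo hp').1.ne' (hρ.trans_lt hp').ne' ?_ v w
  filter_upwards [(isOpen_nearBoundary ρ).mem_nhds hp'] with q hq
  exact hΦ.hillEmbedding_comp hℓ hρ hhp hhm hP hM hq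

end IsFGDiffeo

end

/-! ### Matched frames and the equations for a Fefferman–Graham diffeomorphism -/

/-- The determinant of the frame `(c, s)` at `X` and the frame `(d, e)` at `a`. -/
def wedge (c s d e : ℝ → ℝ) (X a : ℝ) : ℝ := c X * e a - s X * d a

theorem wedge_swap (c s d e : ℝ → ℝ) (X a : ℝ) : wedge d e c s a X = -wedge c s d e X a := by
  simp only [wedge]; ring

theorem ContDiff.wedge {E : Type*} [NormedAddCommGroup E] [NormedSpace ℝ E] {c s d e : ℝ → ℝ}
    (hc : ContDiff ℝ ∞ c) (hs : ContDiff ℝ ∞ s) (hd : ContDiff ℝ ∞ d) (he : ContDiff ℝ ∞ e)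
    {f g : E → ℝ} (hf : ContDiff ℝ ∞ f) (hg : ContDiff ℝ ∞ g) :
    ContDiff ℝ ∞ fun x => wedge c s d e (f x) (g x) :=
  ((hc.comp hf).mul (he.comp hg)).sub ((hs.comp hf).mul (hd.comp hg))

theorem hasDerivAt_wedge {c s : ℝ → ℝ} (d e : ℝ → ℝ) {c' s' X : ℝ} (a : ℝ) (hc : HasDerivAt c c' X)
    (hs : HasDerivAt s s' X) :
    HasDerivAt (fun X => wedge c s d e X a) (c' * e a - s' * d a) X :=
  (hc.mul_const _).sub (hs.mul_const _)

/-- Two frames of Hill solutions that are matched along a map `h` of the circle: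
the directions of `(d, e)` at `a` and of `(c, s)` at `h a` coincide, and both frames have the same
monodromy. -/
structure IsMatching (L c s L' d e h : ℝ → ℝ) : Prop where
  left : IsHillBasis L c s
  right : IsHillBasis L' d e
  monodromy : ∃ α β γ δ : ℝ, α * δ - β * γ = 1 ∧
    (∀ x, c (x + 2 * Real.pi) = α * c x + β * s x) ∧
    (∀ x, s (x + 2 * Real.pi) = γ * c x + δ * s x) ∧
    (∀ x, d (x + 2 * Real.pi) = α * d x + β * e x) ∧
    (∀ x, e (x + 2 * Real.pi) = γ * d x + δ * e x)
  continuous : Continuous h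
  quasiperiodic : ∀ x, h (x + 2 * Real.pi) = h x + 2 * Real.pi
  wedge_eq_zero : ∀ a, wedge c s d e (h a) a = 0
  wedge_deriv_neg : ∀ a, wedge (deriv c) (deriv s) d e (h a) a < 0

theorem wedge_hillTransform {c s d e h : ℝ → ℝ} (a : ℝ) :
    wedge c s (hillTransform d h) (hillTransform e h) (h a) a =
      Real.exp (-(logDerivative h a) / 2) * (c (h a) * e (h a) - s (h a) * d (h a)) := by
  simp only [wedge, hillTransform]; ring

/-- A solution shifted by the period of `L` is again a solution. Its coordinates in the basis are
Wronskians with `c` and `s`, hence constant, and the Wronskian of the shifted basis gives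
determinant `1`. -/
theorem IsHillBasis.exists_monodromy {L c s : ℝ → ℝ} (hb : IsHillBasis L c s)
    (hL : Function.Periodic L (2 * Real.pi)) : ∃ α β γ δ : ℝ, α * δ - β * γ = 1 ∧
    (∀ x, c (x + 2 * Real.pi) = α * c x + β * s x) ∧
    (∀ x, s (x + 2 * Real.pi) = γ * c x + δ * s x) := by
  set T := 2 * Real.pi
  -- the Wronskian of two solutions is constant
  have hW : ∀ u u' v v' : ℝ → ℝ, (∀ x, HasDerivAt u (u' x) x) → (∀ x, HasDerivAt u' (L x * u x) x) →
      (∀ x, HasDerivAt v (v' x) x) → (∀ x, HasDerivAt v' (L x * v x) x) →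
      ∀ x, u x * v' x - u' x * v x = u 0 * v' 0 - u' 0 * v 0 := by
    intro u u' v v' h1 h2 h3 h4 x
    have hd : ∀ x, HasDerivAt (fun x => u x * v' x - u' x * v x) 0 x := fun x =>
      (((h1 x).mul (h4 x)).sub ((h2 x).mul (h3 x))).congr_deriv (by ring)
    exact is_const_of_deriv_eq_zero (fun x => (hd x).differentiableAt) (fun x => (hd x).deriv) x 0
  have hsh : ∀ {u u' : ℝ → ℝ}, (∀ x, HasDerivAt u (u' x) x) →
      ∀ x, HasDerivAt (fun x => u (x + T)) (u' (x + T)) x := fun h x =>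
    (h (x + T)).comp_add_const x T
  have dc := hasDerivAt_of_contDiff hb.smooth_fst
  have ds := hasDerivAt_of_contDiff hb.smooth_snd
  have key : ∀ {u u' : ℝ → ℝ}, (∀ x, HasDerivAt u (u' x) x) →
      (∀ x, HasDerivAt u' (L x * u x) x) → ∃ α β : ℝ, ∀ x, u (x + T) = α * c x + β * s x ∧
        u' (x + T) = α * deriv c x + β * deriv s x := by
    intro u u' h1 h2
    have h1' := hsh h1
    have h2' : ∀ x, HasDerivAt (fun x => u' (x + T)) (L x * u (x + T)) x := fun x => by
      have := (h2 (x + T)).comp_add_const x T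
      rwa [hL x] at this
    have w1 := hW _ _ _ _ h1' h2' ds hb.hill_snd
    have w2 := hW _ _ _ _ h1' h2' dc hb.hill_fst
    refine ⟨u (0 + T) * deriv s 0 - u' (0 + T) * s 0, -(u (0 + T) * deriv c 0 - u' (0 + T) * c 0),
      fun x => ?_⟩
    rw [← w1 x, ← w2 x]
    have := hb.wronskian x
    constructor
    · linear_combination (-(u (x + T))) * this
    · linear_combination (-(u' (x + T))) * this
  obtain ⟨α, β, h1⟩ := key dc hb.hill_fst
  obtain ⟨γ, δ, h2⟩ := key ds hb.hill_snd
  refine ⟨α, β, γ, δ, ?_, fun x => (h1 x).1, fun x => (h2 x).1⟩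
  have h3 := hb.wronskian (0 + T)
  rw [(h1 0).1, (h1 0).2, (h2 0).1, (h2 0).2] at h3
  have := hb.wronskian 0
  linear_combination h3 - (α * δ - β * γ) * this

/-- The weight `e^{-Ψ/2}` is periodic and `h` commutes with the period, so the transform inherits
the monodromy matrix unchanged. -/
theorem IsHillBasis.isMatching {L c s h : ℝ → ℝ} (hb : IsHillBasis L c s)
    (hL : Function.Periodic L (2 * Real.pi)) (hh : IsBoundaryMap h) :
    IsMatching L c s (transformedL L h) (hillTransform c h) (hillTransform s h) h where
  left := hb
  right := hh.isHillBasis_hillTransform hb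
  monodromy := by
    obtain ⟨α, β, γ, δ, h0, h1, h2⟩ := hb.exists_monodromy hL
    refine ⟨α, β, γ, δ, h0, h1, h2, fun x => ?_, fun x => ?_⟩
    · simp only [hillTransform, hh.periodic_logDerivative x, hh.quasiperiodic, h1]; ring
    · simp only [hillTransform, hh.periodic_logDerivative x, hh.quasiperiodic, h2]; ring
  continuous := hh.smooth.continuous
  quasiperiodic := hh.quasiperiodic
  wedge_eq_zero a := by rw [wedge_hillTransform]; ring
  wedge_deriv_neg a := by
    rw [wedge_hillTransform]
    have := hb.wronskian (h a)
    have h1 : deriv c (h a) * s (h a) - deriv s (h a) * c (h a) = -1 := by linarith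
    rw [h1]
    have := Real.exp_pos (-(logDerivative h a) / 2)
    linarith

/-- This symmetry lets the inverse diffeomorphism be found by the same existence theorem. It is also
why a matching is defined without requiring smoothness of `h`. -/
theorem IsMatching.symm {L c s L' d e h k : ℝ → ℝ} (hm : IsMatching L c s L' d e h)
    (hk : Continuous k) (hhk : ∀ x, h (k x) = x)
    (hks : ∀ x, k (x + 2 * Real.pi) = k x + 2 * Real.pi) : IsMatching L' d e L c s k where
  left := hm.right
  right := hm.left
  monodromy := by
    obtain ⟨α, β, γ, δ, h0, h1, h2, h3, h4⟩ := hm.monodromy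
    exact ⟨α, β, γ, δ, h0, h3, h4, h1, h2⟩
  continuous := hk
  quasiperiodic := hks
  wedge_eq_zero x := by
    rw [wedge_swap]
    have := hm.wedge_eq_zero (k x)
    rw [hhk] at this
    rw [this, neg_zero]
  wedge_deriv_neg x := by
    have h0 := hm.wedge_eq_zero (k x)
    have h1 := hm.wedge_deriv_neg (k x)
    rw [hhk] at h0 h1
    have w1 := hm.left.wronskian x
    have w2 := hm.right.wronskian (k x)
    simp only [wedge] at *
    set P := deriv c x * e (k x) - deriv s x * d (k x) with hP
    set Q := deriv d (k x) * s x - deriv e (k x) * c x with hQ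
    -- Where the frame directions coincide, the two derivative determinants are reciprocal, so the
    -- sign passes from one to the other.
    have : P * Q = 1 := by
      rw [hP, hQ]
      linear_combination (c x * deriv s x - deriv c x * s x) * w2 + w1 -
        (deriv c x * deriv e (k x) - deriv s x * deriv d (k x)) * h0
    nlinarith

section

variable {ℓ : ℝ} {Lp cp sp Lp' dp ep hp Lm cm sm Lm' dm em hm : ℝ → ℝ}

/-- The first off-diagonal equation. -/
noncomputable def plusEquation (ℓ : ℝ) (cp sp dp ep cm sm dm em : ℝ → ℝ) (t a b X Y : ℝ) : ℝ :=
  wedge cp sp dp ep X a * wedge (deriv cm) (deriv sm) dm em Y b -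
    ℓ ^ 2 * t * (wedge cp sp (deriv dp) (deriv ep) X a *
      wedge (deriv cm) (deriv sm) (deriv dm) (deriv em) Y b)

/-- The second off-diagonal equation. -/
noncomputable def minusEquation (ℓ : ℝ) (cp sp dp ep cm sm dm em : ℝ → ℝ) (t a b X Y : ℝ) : ℝ :=
  wedge (deriv cp) (deriv sp) dp ep X a * wedge cm sm dm em Y b -
    ℓ ^ 2 * t * (wedge (deriv cp) (deriv sp) (deriv dp) (deriv ep) X a *
      wedge cm sm (deriv dm) (deriv em) Y b)

/-- The ratio of radial coordinates. -/
noncomputable def radialRatio (ℓ : ℝ) (cp sp dp ep cm sm dm em : ℝ → ℝ) (t a b X Y : ℝ) : ℝ :=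
  wedge (deriv cp) (deriv sp) dp ep X a * wedge (deriv cm) (deriv sm) dm em Y b -
    ℓ ^ 2 * t * (wedge (deriv cp) (deriv sp) (deriv dp) (deriv ep) X a *
      wedge (deriv cm) (deriv sm) (deriv dm) (deriv em) Y b)

theorem polar_hillEmbedding_dyad {r : ℝ} (hr : r ≠ 0) (a b x y z w : ℝ) :
    2 * polar (hillEmbedding ℓ dp ep dm em (r, a, b)) (dyad x y z w) =
      r * ((x * ep a - y * dp a) * (z * em b - w * dm b) -
        ℓ ^ 2 * (1 / r ^ 2) * ((x * deriv ep a - y * deriv dp a) *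
          (z * deriv em b - w * deriv dm b))) := by
  simp only [hillEmbedding, polar_sub_left, polar_smul_left, polar_dyad]
  field_simp
  ring

/-- Equality of embedded points, written as equations for the coordinates. -/
theorem hillEmbedding_eq_iff (hP : IsHillBasis Lp cp sp) (hP' : IsHillBasis Lp' dp ep)
    (hM : IsHillBasis Lm cm sm) (hM' : IsHillBasis Lm' dm em) {R X Y r a b : ℝ}
    (hR : R ≠ 0) (hr : r ≠ 0) :
    hillEmbedding ℓ cp sp cm sm (R, X, Y) = hillEmbedding ℓ dp ep dm em (r, a, b) ↔
      plusEquation ℓ cp sp dp ep cm sm dm em (1 / r ^ 2) a b X Y = 0 ∧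
      minusEquation ℓ cp sp dp ep cm sm dm em (1 / r ^ 2) a b X Y = 0 ∧
      R = r * radialRatio ℓ cp sp dp ep cm sm dm em (1 / r ^ 2) a b X Y := by
  have w1 := hP.wronskian X
  have w2 := hM.wronskian Y
  constructor
  · intro h
    -- Pairing with dyads of the frames at `(X, Y)` reads off the dyadic coefficients: two are zero
    -- and one is `R`.
    have c1 := congrArg (fun q => 2 * polar q (dyad (cp X) (sp X) (deriv cm Y) (deriv sm Y))) h
    have c2 := congrArg (fun q => 2 * polar q (dyad (deriv cp X) (deriv sp X) (cm Y) (sm Y))) h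
    have c3 := congrArg
      (fun q => 2 * polar q (dyad (deriv cp X) (deriv sp X) (deriv cm Y) (deriv sm Y))) h
    simp only [polar_hillEmbedding_dyad hR, polar_hillEmbedding_dyad hr] at c1 c2 c3
    have e1 : deriv cp X * sp X - deriv sp X * cp X = -1 := by linarith
    have e2 : deriv cm Y * sm Y - deriv sm Y * cm Y = -1 := by linarith
    have e3 : cp X * sp X - sp X * cp X = 0 := by ring
    have e4 : cm Y * sm Y - sm Y * cm Y = 0 := by ring
    have e5 : deriv cp X * deriv sp X - deriv sp X * deriv cp X = 0 := by ring
    have e6 : deriv cm Y * deriv sm Y - deriv sm Y * deriv cm Y = 0 := by ring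
    rw [e3, e6] at c1
    rw [e4, e5] at c2
    rw [e1, e2, e5] at c3
    refine ⟨?_, ?_, ?_⟩
    · refine (mul_eq_zero.1 (?_ : r * _ = 0)).resolve_left hr
      rw [plusEquation]
      simp only [wedge]
      linarith
    · refine (mul_eq_zero.1 (?_ : r * _ = 0)).resolve_left hr
      rw [minusEquation]
      simp only [wedge]
      linarith
    · rw [radialRatio]
      simp only [wedge]
      linarith
  · rintro ⟨h1, h2, h3⟩
    set B := hillEmbedding ℓ dp ep dm em (r, a, b) with hB
    have hBB : polar B B = -ℓ ^ 2 := polar_hillEmbedding_self hP' hM' hr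
    have b1 : 2 * polar B (dyad (cp X) (sp X) (deriv cm Y) (deriv sm Y)) = 0 := by
      rw [hB, polar_hillEmbedding_dyad hr]
      exact mul_eq_zero_of_right r h1
    have b2 : 2 * polar B (dyad (deriv cp X) (deriv sp X) (cm Y) (sm Y)) = 0 := by
      rw [hB, polar_hillEmbedding_dyad hr]
      exact mul_eq_zero_of_right r h2
    have b3 : 2 * polar B (dyad (deriv cp X) (deriv sp X) (deriv cm Y) (deriv sm Y)) = R := by
      rw [hB, polar_hillEmbedding_dyad hr]
      exact h3.symm
    have h := quad_expansion w1 w2 B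
    rw [b1, b2, b3, zero_smul, zero_smul, sub_zero, sub_zero] at h
    -- The fourth coefficient needs no equation of its own, because `B` lies on the quadric.
    have b4 : 2 * polar B (dyad (cp X) (sp X) (cm Y) (sm Y)) = -(ℓ ^ 2 / R) := by
      have h4 := congrArg (polar B) h
      rw [polar_add_right, polar_smul_right, polar_smul_right, hBB] at h4
      field_simp
      linear_combination (-1 : ℝ) * h4 - polar B (dyad (cp X) (sp X) (cm Y) (sm Y)) * b3
    rw [b4] at h
    rw [h, hillEmbedding, neg_smul, sub_eq_add_neg]

end

/-! ### Asymptotic expansion -/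

theorem isBigO_taylor_two {f : ℝ → ℝ} (hf : ContDiff ℝ ∞ f) (x₀ : ℝ) :
    (fun x => f x - f x₀ - deriv f x₀ * (x - x₀)) =O[𝓝 x₀] fun x => (x - x₀) ^ 2 := by
  have h := (taylor_isLittleO_univ (x₀ := x₀) (n := 2) (hf.of_le (by
    exact WithTop.coe_le_coe.2 (le_top : (2 : ℕ∞) ≤ ⊤)))).isBigO
  have h2 : (fun x => iteratedDerivWithin 2 f univ x₀ / 2 * (x - x₀) ^ 2) =O[𝓝 x₀]
      fun x => (x - x₀) ^ 2 := isBigO_const_mul_self _ _ _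
  refine (h.add h2).congr_left fun x => ?_
  simp only [taylorWithinEval_succ, taylor_within_zero_eval, Nat.factorial, zero_add,
    iteratedDerivWithin_one, derivWithin_univ, smul_eq_mul]
  push_cast
  simp only [iteratedDerivWithin_univ]
  norm_num
  ring

section

variable {l : Filter ℝ} {X Y τ : ℝ → ℝ} {x₀ y₀ ℓ : ℝ} {f g p k : ℝ → ℝ}

theorem isBigO_comp_sub (hf : ContDiff ℝ ∞ f) (hX : Tendsto X l (𝓝 x₀))
    (hO : (fun r => X r - x₀) =O[l] τ) : (fun r => f (X r) - f x₀) =O[l] τ :=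
  ((hasDerivAt_of_contDiff hf x₀).isBigO_sub.comp_tendsto hX).trans hO

theorem isBigO_one_comp (hf : ContDiff ℝ ∞ f) (hX : Tendsto X l (𝓝 x₀)) :
    (fun r => f (X r)) =O[l] fun _ => (1 : ℝ) :=
  ((hf.continuous.tendsto x₀).comp hX).isBigO_one ℝ

/-- First estimate: the deviation from the boundary value is of order `τ`. -/
theorem isBigO_of_equation (hf : ContDiff ℝ ∞ f) (hg : ContDiff ℝ ∞ g) (hp : ContDiff ℝ ∞ p)
    (hk : ContDiff ℝ ∞ k) (hX : Tendsto X l (𝓝 x₀)) (hY : Tendsto Y l (𝓝 y₀)) (hf0 : f x₀ = 0)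
    (hf' : deriv f x₀ ≠ 0) (hg0 : g y₀ ≠ 0)
    (heq : ∀ᶠ r in l, f (X r) * g (Y r) = ℓ ^ 2 * τ r * (p (X r) * k (Y r))) :
    (fun r => X r - x₀) =O[l] τ := by
  -- `f` has a simple zero at `x₀`, so it controls the distance to `x₀`.
  have h1 : (fun r => X r - x₀) =O[l] fun r => f (X r) := by
    have h2 := ((hasDerivAt_of_contDiff hf x₀).isTheta_sub hf').isBigO_symm.comp_tendsto
      (hX.prodMk (tendsto_pure.2 (Eventually.of_forall fun _ => rfl)))
    simpa [Function.comp_def, hf0] using h2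
  have h2 : Tendsto (fun r => g (Y r)) l (𝓝 (g y₀)) := (hg.continuous.tendsto y₀).comp hY
  have h3 : (fun r => (g (Y r))⁻¹) =O[l] fun _ => (1 : ℝ) := (h2.inv₀ hg0).isBigO_one ℝ
  have h4 : (fun r => f (X r)) =ᶠ[l] fun r => ℓ ^ 2 * (τ r * (p (X r) * k (Y r) * (g (Y r))⁻¹)) := by
    filter_upwards [heq, h2.eventually_ne hg0] with r hr hr0
    field_simp
    linear_combination hr
  have h5 := ((isBigO_refl τ l).mul (((isBigO_one_comp hp hX).mul (isBigO_one_comp hk hY)).mul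
    h3)).const_mul_left (ℓ ^ 2)
  simp only [mul_one] at h5
  exact h1.trans (h4.trans_isBigO h5)

/-- Second estimate: the first-order term. -/
theorem isBigO_sq_of_equation (hf : ContDiff ℝ ∞ f) (hg : ContDiff ℝ ∞ g) (hp : ContDiff ℝ ∞ p)
    (hk : ContDiff ℝ ∞ k) (hX : Tendsto X l (𝓝 x₀)) (hY : Tendsto Y l (𝓝 y₀)) (hf0 : f x₀ = 0)
    (hf' : deriv f x₀ ≠ 0) (hg0 : g y₀ ≠ 0)
    (heq : ∀ᶠ r in l, f (X r) * g (Y r) = ℓ ^ 2 * τ r * (p (X r) * k (Y r)))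
    (hXO : (fun r => X r - x₀) =O[l] τ) (hYO : (fun r => Y r - y₀) =O[l] τ)
    {A : ℝ} (hA : A * (deriv f x₀ * g y₀) = p x₀ * k y₀) :
    (fun r => X r - (x₀ + ℓ ^ 2 * τ r * A)) =O[l] fun r => τ r ^ 2 := by
  have hD : deriv f x₀ * g y₀ ≠ 0 := mul_ne_zero hf' hg0
  have a1 : (fun r => f (X r) - f x₀ - deriv f x₀ * (X r - x₀)) =O[l] fun r => τ r ^ 2 :=
    ((isBigO_taylor_two hf x₀).comp_tendsto hX).trans (hXO.pow 2)
  have a2 : (fun r => f (X r) * (g (Y r) - g y₀)) =O[l] fun r => τ r ^ 2 := by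
    have := (isBigO_comp_sub hf hX hXO).mul (isBigO_comp_sub hg hY hYO)
    simpa only [hf0, sub_zero, ← sq] using this
  have a3 : (fun r => τ r * ((p (X r) - p x₀) * k (Y r) + p x₀ * (k (Y r) - k y₀))) =O[l]
      fun r => τ r ^ 2 := by
    have h1 := (isBigO_comp_sub hp hX hXO).mul (isBigO_one_comp hk hY)
    simp only [mul_one] at h1
    have h2 := (isBigO_refl τ l).mul (h1.add ((isBigO_comp_sub hk hY hYO).const_mul_left (p x₀)))
    simpa only [← sq] using h2
  have a4 := ((a3.const_mul_left (ℓ ^ 2)).sub ((a1.const_mul_left (g y₀)).add a2)).const_mul_left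
    (deriv f x₀ * g y₀)⁻¹
  refine a4.congr' ?_ EventuallyEq.rfl
  filter_upwards [heq] with r hr
  rw [inv_mul_eq_iff_eq_mul₀ hD, hf0]
  linear_combination -hr + (ℓ ^ 2 * τ r) * hA

end

section

variable {ℓ ρ : ℝ} {Lp Lm hp hm cp sp cm sm : ℝ → ℝ} {Φ : Coord → Coord}

theorem deriv_wedge {c s : ℝ → ℝ} (d e : ℝ → ℝ) (hc : ContDiff ℝ ∞ c) (hs : ContDiff ℝ ∞ s)
    (X a : ℝ) : deriv (fun X => wedge c s d e X a) X = wedge (deriv c) (deriv s) d e X a :=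
  (hasDerivAt_wedge d e a (hasDerivAt_of_contDiff hc X) (hasDerivAt_of_contDiff hs X)).deriv

/-- The values of the four frame determinants on the graph of the boundary map. -/
theorem IsHillBasis.wedge_values {L c s h : ℝ → ℝ} (hb : IsHillBasis L c s) (hh : IsBoundaryMap h)
    (a : ℝ) :
    wedge c s (hillTransform c h) (hillTransform s h) (h a) a = 0 ∧
    wedge (deriv c) (deriv s) (hillTransform c h) (hillTransform s h) (h a) a =
      -Real.exp (-(logDerivative h a) / 2) ∧
    wedge c s (deriv (hillTransform c h)) (deriv (hillTransform s h)) (h a) a =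
      Real.exp (logDerivative h a / 2) ∧
    wedge (deriv c) (deriv s) (deriv (hillTransform c h)) (deriv (hillTransform s h)) (h a) a =
      1 / 2 * deriv (logDerivative h) a * Real.exp (-(logDerivative h a) / 2) := by
  have w := hb.wronskian (h a)
  rw [hh.deriv_hillTransform hb.smooth_fst, hh.deriv_hillTransform hb.smooth_snd]
  simp only [wedge, hillTransform]
  refine ⟨by ring, ?_, ?_, ?_⟩
  · linear_combination (-Real.exp (-(logDerivative h a) / 2)) * w
  · linear_combination Real.exp (logDerivative h a / 2) * w
  · linear_combination (1 / 2 * deriv (logDerivative h) a *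
      Real.exp (-(logDerivative h a) / 2)) * w

theorem contDiff_wedge_left {c s d e : ℝ → ℝ} (hc : ContDiff ℝ ∞ c) (hs : ContDiff ℝ ∞ s) (a : ℝ) :
    ContDiff ℝ ∞ fun X => wedge c s d e X a :=
  (hc.mul contDiff_const).sub (hs.mul contDiff_const)

theorem IsBoundaryMap.deriv_logDerivative {h : ℝ → ℝ} (hh : IsBoundaryMap h) (a : ℝ) :
    deriv (logDerivative h) a = iteratedDeriv 2 h a / deriv h a := by
  rw [iteratedDeriv_two_eq, hh.deriv_deriv, hh.exp_logDerivative,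
    mul_div_cancel_right₀ _ (hh.deriv_pos a).ne']

/-- Both off-diagonal equations have the form `f(X) g(Y) = ℓ² τ p(X) k(Y)` with `τ = 1/r²` and a
simple zero of `f` at the boundary value, with the roles of `X⁺` and `X⁻` exchanged between them. -/
theorem IsFGDiffeo.expansion (hΦ : IsFGDiffeo ℓ Lp Lm hp hm ρ Φ) (hℓ : 0 < ℓ) (hρ : 0 ≤ ρ)
    (hhp : IsBoundaryMap hp) (hhm : IsBoundaryMap hm) (hP : IsHillBasis Lp cp sp)
    (hM : IsHillBasis Lm cm sm) (a b : ℝ) :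
    ((fun r : ℝ => (Φ (r, a, b)).2.1 -
        (hp a + ℓ ^ 2 / (2 * r ^ 2) * (iteratedDeriv 2 hm b / deriv hm b) * deriv hp a))
      =O[atTop] fun r : ℝ => 1 / r ^ 4) ∧
    ((fun r : ℝ => (Φ (r, a, b)).2.2 -
        (hm b + ℓ ^ 2 / (2 * r ^ 2) * (iteratedDeriv 2 hp a / deriv hp a) * deriv hm b))
      =O[atTop] fun r : ℝ => 1 / r ^ 4) ∧
    ((fun r : ℝ => (Φ (r, a, b)).1 - r / √(deriv hp a * deriv hm b))
      =O[atTop] fun r : ℝ => 1 / r) := by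
  have hX := hΦ.tendsto_plus a b
  have hY := hΦ.tendsto_minus a b
  set X : ℝ → ℝ := fun r => (Φ (r, a, b)).2.1 with hXdef
  set Y : ℝ → ℝ := fun r => (Φ (r, a, b)).2.2 with hYdef
  set dp := hillTransform cp hp with hdp
  set ep := hillTransform sp hp with hep
  set dm := hillTransform cm hm with hdm
  set em := hillTransform sm hm with hem
  have hP' := hhp.isHillBasis_hillTransform hP
  have hM' := hhm.isHillBasis_hillTransform hM
  have key : ∀ r, ρ < r → plusEquation ℓ cp sp dp ep cm sm dm em (1 / r ^ 2) a b (X r) (Y r) = 0 ∧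
      minusEquation ℓ cp sp dp ep cm sm dm em (1 / r ^ 2) a b (X r) (Y r) = 0 ∧
      (Φ (r, a, b)).1 = r * radialRatio ℓ cp sp dp ep cm sm dm em (1 / r ^ 2) a b (X r) (Y r) := by
    intro r hr
    have hmem : (r, a, b) ∈ nearBoundary ρ := hr
    refine (hillEmbedding_eq_iff hP hP' hM hM' (hΦ.mapsTo hmem).1.ne' (hρ.trans_lt hr).ne').1 ?_
    exact hΦ.hillEmbedding_comp hℓ hρ hhp hhm hP hM hmem
  obtain ⟨p00, p10, p01, p11⟩ := hP.wedge_values hhp a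
  obtain ⟨m00, m10, m01, m11⟩ := hM.wedge_values hhm b
  have dcp := contDiff_deriv hP.smooth_fst
  have dsp := contDiff_deriv hP.smooth_snd
  have dcm := contDiff_deriv hM.smooth_fst
  have dsm := contDiff_deriv hM.smooth_snd
  set τ : ℝ → ℝ := fun r => 1 / r ^ 2 with hτ
  have ep0 := (Real.exp_pos (-(logDerivative hp a) / 2)).ne'
  have em0 := (Real.exp_pos (-(logDerivative hm b) / 2)).ne'
  have heq1 : ∀ᶠ r in atTop, wedge cp sp dp ep (X r) a *
      wedge (deriv cm) (deriv sm) dm em (Y r) b = ℓ ^ 2 * τ r *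
        (wedge cp sp (deriv dp) (deriv ep) (X r) a *
          wedge (deriv cm) (deriv sm) (deriv dm) (deriv em) (Y r) b) := by
    filter_upwards [eventually_gt_atTop ρ] with r hr
    exact sub_eq_zero.1 (key r hr).1
  have heq2 : ∀ᶠ r in atTop, wedge cm sm dm em (Y r) b *
      wedge (deriv cp) (deriv sp) dp ep (X r) a = ℓ ^ 2 * τ r *
        (wedge cm sm (deriv dm) (deriv em) (Y r) b *
          wedge (deriv cp) (deriv sp) (deriv dp) (deriv ep) (X r) a) := by
    filter_upwards [eventually_gt_atTop ρ] with r hr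
    have := sub_eq_zero.1 (key r hr).2.1
    linear_combination this
  have np : deriv (fun X => wedge cp sp dp ep X a) (hp a) ≠ 0 := by
    rw [deriv_wedge _ _ hP.smooth_fst hP.smooth_snd, p10]; exact neg_ne_zero.2 ep0
  have nm : deriv (fun Y => wedge cm sm dm em Y b) (hm b) ≠ 0 := by
    rw [deriv_wedge _ _ hM.smooth_fst hM.smooth_snd, m10]; exact neg_ne_zero.2 em0
  have np' : wedge (deriv cp) (deriv sp) dp ep (hp a) a ≠ 0 := by
    rw [p10]; exact neg_ne_zero.2 ep0
  have nm' : wedge (deriv cm) (deriv sm) dm em (hm b) b ≠ 0 := by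
    rw [m10]; exact neg_ne_zero.2 em0
  have s1 := contDiff_wedge_left (d := dp) (e := ep) hP.smooth_fst hP.smooth_snd a
  have s2 := contDiff_wedge_left (d := dp) (e := ep) dcp dsp a
  have s3 := contDiff_wedge_left (d := deriv dp) (e := deriv ep) hP.smooth_fst hP.smooth_snd a
  have s4 := contDiff_wedge_left (d := deriv dp) (e := deriv ep) dcp dsp a
  have t1 := contDiff_wedge_left (d := dm) (e := em) hM.smooth_fst hM.smooth_snd b
  have t2 := contDiff_wedge_left (d := dm) (e := em) dcm dsm b
  have t3 := contDiff_wedge_left (d := deriv dm) (e := deriv em) hM.smooth_fst hM.smooth_snd b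
  have t4 := contDiff_wedge_left (d := deriv dm) (e := deriv em) dcm dsm b
  have hXO : (fun r => X r - hp a) =O[atTop] τ :=
    isBigO_of_equation s1 t2 s3 t4 hX hY p00 np nm' heq1
  have hYO : (fun r => Y r - hm b) =O[atTop] τ :=
    isBigO_of_equation t1 s2 t3 s4 hY hX m00 nm np' heq2
  have e1 := exp_logDerivative_half_mul hp a
  have e2 := exp_logDerivative_half_mul hm b
  -- The coefficient is the quotient of the determinants on the graph: `e^{Ψ₊/2} · ½Ψ₋' e^{-Ψ₋/2}`
  -- over `e^{-Ψ₊/2} e^{-Ψ₋/2}`, that is `½ Ψ₋' h₊'`.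
  have hX2 := isBigO_sq_of_equation s1 t2 s3 t4 hX hY p00 np nm' heq1 hXO hYO
    (A := 1 / 2 * deriv (logDerivative hm) b * deriv hp a) (by
      rw [deriv_wedge _ _ hP.smooth_fst hP.smooth_snd, p10, m10, p01, m11,
        hhp.deriv_eq_exp_mul_exp]
      linear_combination (1 / 2 * deriv (logDerivative hm) b *
        Real.exp (-(logDerivative hm b) / 2) * Real.exp (logDerivative hp a / 2)) * e1)
  have hY2 := isBigO_sq_of_equation t1 s2 t3 s4 hY hX m00 nm np' heq2 hYO hXO
    (A := 1 / 2 * deriv (logDerivative hp) a * deriv hm b) (by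
      rw [deriv_wedge _ _ hM.smooth_fst hM.smooth_snd, p10, m10, m01, p11,
        hhm.deriv_eq_exp_mul_exp]
      linear_combination (1 / 2 * deriv (logDerivative hp) a *
        Real.exp (-(logDerivative hp a) / 2) * Real.exp (logDerivative hm b / 2)) * e2)
  have hτ2 : (fun r => τ r ^ 2) = fun r : ℝ => 1 / r ^ 4 := by
    funext r; simp only [hτ, div_pow, one_pow, ← pow_mul]
  rw [hτ2] at hX2 hY2
  refine ⟨hX2.congr_left fun r => ?_, hY2.congr_left fun r => ?_, ?_⟩
  · rw [hhm.deriv_logDerivative]; simp only [hτ]; ring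
  · rw [hhp.deriv_logDerivative]; simp only [hτ]; ring
  · have b1 := (isBigO_comp_sub s2 hX hXO).mul (isBigO_one_comp t2 hY)
    have b2 := (isBigO_comp_sub t2 hY hYO).const_mul_left
      (wedge (deriv cp) (deriv sp) dp ep (hp a) a)
    have b3 := ((isBigO_refl τ atTop).mul ((isBigO_one_comp s4 hX).mul
      (isBigO_one_comp t4 hY))).const_mul_left (ℓ ^ 2)
    simp only [mul_one] at b1 b3
    have b4 := (isBigO_refl (fun r : ℝ => r) atTop).mul ((b1.add b2).sub b3)
    refine b4.congr' ?_ ?_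
    · filter_upwards [eventually_gt_atTop ρ] with r hr
      rw [(key r hr).2.2, radialRatio, div_eq_mul_one_div r, one_div_sqrt_mul_deriv hhp hhm, p10,
        m10]
      ring
    · filter_upwards [eventually_gt_atTop 0] with r hr
      simp only [hτ]
      field_simp

end

/-! ### Solving the equations near the boundary -/

/-- Both frames are multiplied by the same matrix of determinant `1`, which preserves the
determinant of the pair. -/
theorem wedge_add_int_mul {c s d e : ℝ → ℝ} {α β γ δ T : ℝ} (h0 : α * δ - β * γ = 1)
    (hc : ∀ x, c (x + T) = α * c x + β * s x) (hs : ∀ x, s (x + T) = γ * c x + δ * s x)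
    (hd : ∀ x, d (x + T) = α * d x + β * e x) (he : ∀ x, e (x + T) = γ * d x + δ * e x)
    (n : ℤ) (X a : ℝ) : wedge c s d e (X + n * T) (a + n * T) = wedge c s d e X a := by
  have hp : Function.Periodic (fun t => wedge c s d e (X + t) (a + t)) T := fun t => by
    simp only [wedge, ← add_assoc, hc, hs, hd, he]
    linear_combination (c (X + t) * e (a + t) - s (X + t) * d (a + t)) * h0
  have := hp.int_mul n 0
  simpa using this

theorem deriv_monodromy {u c s : ℝ → ℝ} {α β T : ℝ} (hc : ContDiff ℝ ∞ c) (hs : ContDiff ℝ ∞ s)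
    (h : ∀ x, u (x + T) = α * c x + β * s x) (x : ℝ) :
    deriv u (x + T) = α * deriv c x + β * deriv s x := by
  rw [← deriv_comp_add_const, funext h]
  exact (((hasDerivAt_of_contDiff hc x).const_mul α).add
    ((hasDerivAt_of_contDiff hs x).const_mul β)).deriv

/-- Derivatives of the frames share their monodromy. Since each chirality is invariant separately,
the matching system is invariant under all of `2πℤ²` and not only under the identification; this
provides a compact boundary cell. -/
theorem IsMatching.wedge_shift {L c s L' d e h : ℝ → ℝ} (hm : IsMatching L c s L' d e h) (n : ℤ)
    (X a : ℝ) :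
    wedge c s d e (X + n * (2 * Real.pi)) (a + n * (2 * Real.pi)) = wedge c s d e X a ∧
    wedge (deriv c) (deriv s) d e (X + n * (2 * Real.pi)) (a + n * (2 * Real.pi)) =
      wedge (deriv c) (deriv s) d e X a ∧
    wedge c s (deriv d) (deriv e) (X + n * (2 * Real.pi)) (a + n * (2 * Real.pi)) =
      wedge c s (deriv d) (deriv e) X a ∧
    wedge (deriv c) (deriv s) (deriv d) (deriv e) (X + n * (2 * Real.pi)) (a + n * (2 * Real.pi)) =
      wedge (deriv c) (deriv s) (deriv d) (deriv e) X a := by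
  obtain ⟨α, β, γ, δ, h0, hc, hs, hd, he⟩ := hm.monodromy
  have sc := hm.left.smooth_fst
  have ss := hm.left.smooth_snd
  have sd := hm.right.smooth_fst
  have se := hm.right.smooth_snd
  have hc' := deriv_monodromy sc ss hc
  have hs' := deriv_monodromy sc ss hs
  have hd' := deriv_monodromy sd se hd
  have he' := deriv_monodromy sd se he
  exact ⟨wedge_add_int_mul h0 hc hs hd he n X a, wedge_add_int_mul h0 hc' hs' hd he n X a,
    wedge_add_int_mul h0 hc hs hd' he' n X a, wedge_add_int_mul h0 hc' hs' hd' he' n X a⟩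

theorem IsMatching.map_add_int_mul {L c s L' d e h : ℝ → ℝ} (hm : IsMatching L c s L' d e h)
    (n : ℤ) (a : ℝ) : h (a + n * (2 * Real.pi)) = h a + n * (2 * Real.pi) := by
  have hp : Function.Periodic (fun x => h x - x) (2 * Real.pi) := fun x => by
    simp only [hm.quasiperiodic]; ring
  have := hp.int_mul n a
  linarith

/-- The boundary map on `(t, x⁺, x⁻)`. -/
def boundaryPair (hp hm : ℝ → ℝ) (p : Coord) : ℝ × ℝ := (hp p.2.1, hm p.2.2)

/-- The system of the two off-diagonal equations. -/
noncomputable def matchingSystem (ℓ : ℝ) (cp sp dp ep cm sm dm em : ℝ → ℝ) (x : Coord × ℝ × ℝ) :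
    ℝ × ℝ :=
  (plusEquation ℓ cp sp dp ep cm sm dm em x.1.1 x.1.2.1 x.1.2.2 x.2.1 x.2.2,
    minusEquation ℓ cp sp dp ep cm sm dm em x.1.1 x.1.2.1 x.1.2.2 x.2.1 x.2.2)

/-- The radial ratio as a function of `((t, x⁺, x⁻), (X⁺, X⁻))`. -/
noncomputable def matchingRatio (ℓ : ℝ) (cp sp dp ep cm sm dm em : ℝ → ℝ) (x : Coord × ℝ × ℝ) : ℝ :=
  radialRatio ℓ cp sp dp ep cm sm dm em x.1.1 x.1.2.1 x.1.2.2 x.2.1 x.2.2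

section

variable {ℓ : ℝ} {Lp cp sp Lp' dp ep hp Lm cm sm Lm' dm em hm : ℝ → ℝ}

theorem boundaryPair_shift (mp : IsMatching Lp cp sp Lp' dp ep hp)
    (mm : IsMatching Lm cm sm Lm' dm em hm) (n m : ℤ) (p : Coord) :
    boundaryPair hp hm (p + latticeShift n m) = boundaryPair hp hm p + (latticeShift n m).2 := by
  simp only [boundaryPair, latticeShift, Prod.fst_add, Prod.snd_add, mp.map_add_int_mul,
    mm.map_add_int_mul, Prod.mk_add_mk]

theorem continuous_boundaryPair (mp : IsMatching Lp cp sp Lp' dp ep hp)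
    (mm : IsMatching Lm cm sm Lm' dm em hm) : Continuous (boundaryPair hp hm) :=
  (mp.continuous.comp (by fun_prop)).prodMk (mm.continuous.comp (by fun_prop))

theorem matchingSystem_shift (mp : IsMatching Lp cp sp Lp' dp ep hp)
    (mm : IsMatching Lm cm sm Lm' dm em hm) (n m : ℤ) (p : Coord) (z : ℝ × ℝ) :
    matchingSystem ℓ cp sp dp ep cm sm dm em (p + latticeShift n m, z + (latticeShift n m).2) =
      matchingSystem ℓ cp sp dp ep cm sm dm em (p, z) := by
  obtain ⟨p1, p2, p3, p4⟩ := mp.wedge_shift n z.1 p.2.1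
  obtain ⟨m1, m2, m3, m4⟩ := mm.wedge_shift m z.2 p.2.2
  simp only [matchingSystem, plusEquation, minusEquation, latticeShift, Prod.fst_add, Prod.snd_add,
    add_zero, p1, p2, p3, p4, m1, m2, m3, m4]

theorem matchingRatio_shift (mp : IsMatching Lp cp sp Lp' dp ep hp)
    (mm : IsMatching Lm cm sm Lm' dm em hm) (n m : ℤ) (p : Coord) (z : ℝ × ℝ) :
    matchingRatio ℓ cp sp dp ep cm sm dm em (p + latticeShift n m, z + (latticeShift n m).2) =
      matchingRatio ℓ cp sp dp ep cm sm dm em (p, z) := by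
  obtain ⟨p1, p2, p3, p4⟩ := mp.wedge_shift n z.1 p.2.1
  obtain ⟨m1, m2, m3, m4⟩ := mm.wedge_shift m z.2 p.2.2
  simp only [matchingRatio, radialRatio, latticeShift, Prod.fst_add, Prod.snd_add,
    add_zero, p2, p4, m2, m4]

theorem contDiff_matching (mp : IsMatching Lp cp sp Lp' dp ep hp)
    (mm : IsMatching Lm cm sm Lm' dm em hm) :
    ContDiff ℝ ∞ (matchingSystem ℓ cp sp dp ep cm sm dm em) ∧
      ContDiff ℝ ∞ (matchingRatio ℓ cp sp dp ep cm sm dm em) := by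
  have hX : ContDiff ℝ ∞ fun x : Coord × ℝ × ℝ => x.2.1 := by fun_prop
  have hY : ContDiff ℝ ∞ fun x : Coord × ℝ × ℝ => x.2.2 := by fun_prop
  have ha : ContDiff ℝ ∞ fun x : Coord × ℝ × ℝ => x.1.2.1 := by fun_prop
  have hb : ContDiff ℝ ∞ fun x : Coord × ℝ × ℝ => x.1.2.2 := by fun_prop
  have ht : ContDiff ℝ ∞ fun x : Coord × ℝ × ℝ => ℓ ^ 2 * x.1.1 := by fun_prop
  have c1 := mp.left.smooth_fst
  have c2 := mp.left.smooth_snd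
  have c3 := mp.right.smooth_fst
  have c4 := mp.right.smooth_snd
  have d1 := mm.left.smooth_fst
  have d2 := mm.left.smooth_snd
  have d3 := mm.right.smooth_fst
  have d4 := mm.right.smooth_snd
  have c1' := contDiff_deriv c1
  have c2' := contDiff_deriv c2
  have c3' := contDiff_deriv c3
  have c4' := contDiff_deriv c4
  have d1' := contDiff_deriv d1
  have d2' := contDiff_deriv d2
  have d3' := contDiff_deriv d3
  have d4' := contDiff_deriv d4
  refine ⟨ContDiff.prodMk ?_ ?_, ?_⟩
  · exact ((ContDiff.wedge c1 c2 c3 c4 hX ha).mul (ContDiff.wedge d1' d2' d3 d4 hY hb)).sub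
      (ht.mul ((ContDiff.wedge c1 c2 c3' c4' hX ha).mul (ContDiff.wedge d1' d2' d3' d4' hY hb)))
  · exact ((ContDiff.wedge c1' c2' c3 c4 hX ha).mul (ContDiff.wedge d1 d2 d3 d4 hY hb)).sub
      (ht.mul ((ContDiff.wedge c1' c2' c3' c4' hX ha).mul (ContDiff.wedge d1 d2 d3' d4' hY hb)))
  · exact ((ContDiff.wedge c1' c2' c3 c4 hX ha).mul (ContDiff.wedge d1' d2' d3 d4 hY hb)).sub
      (ht.mul ((ContDiff.wedge c1' c2' c3' c4' hX ha).mul (ContDiff.wedge d1' d2' d3' d4' hY hb)))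

theorem matchingSystem_boundary (mp : IsMatching Lp cp sp Lp' dp ep hp)
    (mm : IsMatching Lm cm sm Lm' dm em hm) {p : Coord} (hp0 : p.1 = 0) :
    matchingSystem ℓ cp sp dp ep cm sm dm em (p, boundaryPair hp hm p) = 0 := by
  simp only [matchingSystem, plusEquation, minusEquation, boundaryPair, hp0, mp.wedge_eq_zero,
    mm.wedge_eq_zero]
  simp

theorem matchingRatio_boundary_pos (mp : IsMatching Lp cp sp Lp' dp ep hp)
    (mm : IsMatching Lm cm sm Lm' dm em hm) {p : Coord} (hp0 : p.1 = 0) :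
    0 < matchingRatio ℓ cp sp dp ep cm sm dm em (p, boundaryPair hp hm p) := by
  simp only [matchingRatio, radialRatio, boundaryPair, hp0, mul_zero, zero_mul, sub_zero]
  exact mul_pos_of_neg_of_neg (mp.wedge_deriv_neg _) (mm.wedge_deriv_neg _)

/-- At `t = 0` the system is `(F(X) G'(Y), F'(X) G(Y))` with `F = G = 0` on the graph, so its
Jacobian in `(X, Y)` is the nonzero scalar `F' G'` times the identity. -/
theorem matchingSystem_nondegenerate (mp : IsMatching Lp cp sp Lp' dp ep hp)
    (mm : IsMatching Lm cm sm Lm' dm em hm) {p : Coord} (hp0 : p.1 = 0) {w : ℝ × ℝ}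
    (hw : fderiv ℝ (matchingSystem ℓ cp sp dp ep cm sm dm em) (p, boundaryPair hp hm p) (0, w) = 0) :
    w = 0 := by
  set x : Coord × ℝ × ℝ := (p, boundaryPair hp hm p) with hx
  have hd := ((contDiff_matching (ℓ := ℓ) mp mm).1.differentiable (by simp)) x
  have hline : HasDerivAt (fun s : ℝ => x + s • ((0, w) : Coord × ℝ × ℝ)) (0, w) 0 := by
    simpa using ((hasDerivAt_id (0 : ℝ)).smul_const ((0, w) : Coord × ℝ × ℝ)).const_add x
  have hd0 : HasFDerivAt (matchingSystem ℓ cp sp dp ep cm sm dm em)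
      (fderiv ℝ (matchingSystem ℓ cp sp dp ep cm sm dm em) x) (x + (0 : ℝ) • (0, w)) := by
    simpa using hd.hasFDerivAt
  have h1 := hd0.comp_hasDerivAt (0 : ℝ) hline
  rw [hw] at h1
  have hwedge : ∀ {c s : ℝ → ℝ} (d e : ℝ → ℝ) (X v a : ℝ), ContDiff ℝ ∞ c → ContDiff ℝ ∞ s →
      HasDerivAt (fun t : ℝ => wedge c s d e (X + t * v) a)
        (wedge (deriv c) (deriv s) d e X a * v) 0 := by
    intro c s d e X v a hc hs
    have l : HasDerivAt (fun t : ℝ => X + t * v) v 0 := by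
      simpa using ((hasDerivAt_id (0 : ℝ)).mul_const v).const_add X
    have h0 : HasDerivAt (fun X => wedge c s d e X a) (wedge (deriv c) (deriv s) d e X a)
        (X + 0 * v) := by
      simpa using! hasDerivAt_wedge d e a (hasDerivAt_of_contDiff hc X) (hasDerivAt_of_contDiff hs X)
    exact h0.comp (0 : ℝ) l
  have c1 := mp.left.smooth_fst
  have c2 := mp.left.smooth_snd
  have d1 := mm.left.smooth_fst
  have d2 := mm.left.smooth_snd
  have k1 := (hwedge dp ep (hp p.2.1) w.1 p.2.1 c1 c2).mul
    (hwedge dm em (hm p.2.2) w.2 p.2.2 (contDiff_deriv d1) (contDiff_deriv d2))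
  have k2 := (hwedge dp ep (hp p.2.1) w.1 p.2.1 (contDiff_deriv c1) (contDiff_deriv c2)).mul
    (hwedge dm em (hm p.2.2) w.2 p.2.2 d1 d2)
  have h2 := k1.prodMk k2
  have h3 := h1.unique (h2.congr_of_eventuallyEq (Eventually.of_forall fun s => by
    simp [matchingSystem, plusEquation, minusEquation, hx, hp0, boundaryPair]))
  simp only [zero_mul, add_zero, mp.wedge_eq_zero, mm.wedge_eq_zero] at h3
  have n1 := (mp.wedge_deriv_neg p.2.1).ne
  have n2 := (mm.wedge_deriv_neg p.2.2).ne
  have h4 := congrArg Prod.fst h3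
  have h5 := congrArg Prod.snd h3
  simp only [Prod.fst_zero, Prod.snd_zero] at h4 h5
  ext
  · simpa [n1, n2] using h4.symm
  · simpa [n1, n2] using h5.symm

/-- The solution of the matching equations in a uniform neighbourhood of the boundary. -/
theorem exists_matching_solution (ℓ : ℝ) (mp : IsMatching Lp cp sp Lp' dp ep hp)
    (mm : IsMatching Lm cm sm Lm' dm em hm) :
    ∃ δ > 0, ∃ κ > 0, ∃ q₀ > 0, ∃ S : Coord → ℝ × ℝ,
      (∀ p : Coord, |p.1| < δ → matchingSystem ℓ cp sp dp ep cm sm dm em (p, S p) = 0 ∧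
        ContDiffAt ℝ ∞ S p ∧ q₀ < matchingRatio ℓ cp sp dp ep cm sm dm em (p, S p)) ∧
      (∀ (p : Coord) (z : ℝ × ℝ), |p.1| < δ → dist z (boundaryPair hp hm p) < κ →
        matchingSystem ℓ cp sp dp ep cm sm dm em (p, z) = 0 → z = S p) ∧
      (∀ κ' > 0, ∃ δ' > 0, ∀ p : Coord, |p.1| < δ' → dist (S p) (boundaryPair hp hm p) < κ') ∧
      ∀ n m p, |p.1| < δ → S (p + latticeShift n m) = S p + (latticeShift n m).2 := by
  have hH := continuous_boundaryPair mp mm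
  have hHs := boundaryPair_shift mp mm
  obtain ⟨hE, hQ⟩ := contDiff_matching (ℓ := ℓ) mp mm
  obtain ⟨δ, hδ, κ, hκ, S, hS, huniq, hsmall, hshift⟩ := exists_implicit_of_equivariant hE hH
    (fun _ => rfl) (fun p => matchingSystem_boundary mp mm)
    (fun p hp0 w => matchingSystem_nondegenerate mp mm hp0)
    (matchingSystem_shift mp mm) hHs
  -- The radial ratio is positive on the boundary graph; its minimum over the cell gives a bound
  -- which, halved, persists on a uniform neighbourhood.
  obtain ⟨p₀, hp₀, hmin⟩ := isCompact_boundaryCell.exists_isMinOn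
    (f := fun p => matchingRatio ℓ cp sp dp ep cm sm dm em (p, boundaryPair hp hm p))
    ⟨(0, 0, 0), rfl, ⟨le_rfl, Real.two_pi_pos.le⟩, le_rfl, Real.two_pi_pos.le⟩
    (hQ.continuous.comp (by fun_prop)).continuousOn
  set q := matchingRatio ℓ cp sp dp ep cm sm dm em (p₀, boundaryPair hp hm p₀) with hq
  have hq0 : 0 < q := matchingRatio_boundary_pos mp mm hp₀.1
  obtain ⟨ε, hε, hεU⟩ := exists_uniform_of_isOpen_of_shift
    (U := {x | q / 2 < matchingRatio ℓ cp sp dp ep cm sm dm em x})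
    (isOpen_lt continuous_const hQ.continuous) hH (fun _ => rfl)
    (fun p hp' => (half_lt_self hq0).trans_le (hmin hp'))
    (fun n m p z h => by rw [Set.mem_ofPred_eq, matchingRatio_shift mp mm]; exact h) hHs
  obtain ⟨δ₁, hδ₁, h₁⟩ := hsmall (min κ ε) (lt_min hκ hε)
  have m1 : min δ (min ε δ₁) ≤ δ := min_le_left _ _
  have m2 : min δ (min ε δ₁) ≤ ε := (min_le_right _ _).trans (min_le_left _ _)
  have m3 : min δ (min ε δ₁) ≤ δ₁ := (min_le_right _ _).trans (min_le_right _ _)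
  refine ⟨min δ (min ε δ₁), lt_min hδ (lt_min hε hδ₁), κ, hκ, q / 2, half_pos hq0, S,
    fun p h => ⟨(hS p (h.trans_le m1)).1, (hS p (h.trans_le m1)).2,
      hεU p (S p) (h.trans_le m2) ((h₁ p (h.trans_le m3)).trans_le (min_le_right _ _))⟩,
    fun p z h hz h0 => huniq p z (S p) (h.trans_le m1) hz
      ((h₁ p (h.trans_le m3)).trans_le (min_le_left _ _)) h0 (hS p (h.trans_le m1)).1,
    hsmall, fun n m p h => hshift n m p (h.trans_le m1)⟩

/-- Points close to the graph of the boundary map are close to the graph of its inverse. -/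
theorem exists_dist_inverse_lt {kp km : ℝ → ℝ} (mp : IsMatching Lp cp sp Lp' dp ep hp)
    (mm : IsMatching Lm cm sm Lm' dm em hm) (mp' : IsMatching Lp' dp ep Lp cp sp kp)
    (mm' : IsMatching Lm' dm em Lm cm sm km) (hkp : ∀ x, kp (hp x) = x) (hkm : ∀ x, km (hm x) = x)
    {κ' : ℝ} (hκ' : 0 < κ') : ∃ κ > 0, ∀ p z : Coord, dist z.2 (boundaryPair hp hm p) < κ →
      dist p.2 (boundaryPair kp km z) < κ' := by
  have hK := continuous_boundaryPair mp' mm'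
  obtain ⟨ε, hε, h⟩ := exists_uniform_of_isOpen_of_shift
    (U := {x | dist x.1.2 (boundaryPair kp km (0, x.2)) < κ'})
    (isOpen_lt (by fun_prop) continuous_const) (continuous_boundaryPair mp mm) (fun _ => rfl)
    (fun p _ => by simpa [boundaryPair, hkp, hkm] using hκ')
    (fun n m p z h => by
      have e : ((0 : ℝ), z + (latticeShift n m).2) = ((0, z) : Coord) + latticeShift n m := by
        ext <;> simp [latticeShift]
      rw [Set.mem_ofPred_eq, e, boundaryPair_shift mp' mm', Prod.snd_add, dist_add_right]
      exact h) (boundaryPair_shift mp mm)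
  exact ⟨ε, hε, fun p z hz => h (0, p.2) z.2 (by simpa using hε) hz⟩

end

/-! ### Existence of Fefferman–Graham diffeomorphisms -/

theorem deck_eq_add_latticeShift (p : Coord) : deck p = p + latticeShift 1 (-1) := by
  ext <;> simp [deck, latticeShift, sub_eq_add_neg]

theorem isFeffermanGrahamOn_banadosMetric (ℓ : ℝ) (Lp Lm : ℝ → ℝ) (U : Set Coord) :
    IsFeffermanGrahamOn ℓ U (banadosMetric ℓ Lp Lm) := fun p _ => by
  refine ⟨?_, ?_, ?_⟩ <;> simp [banadosMetric]

theorem exists_bound_mul {L L' : ℝ → ℝ} (hL : IsBanadosFunction L) (hL' : IsBanadosFunction L')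
    (ℓ : ℝ) : ∃ M : ℝ, ∀ x y, ℓ ^ 4 * L x * L' y ≤ M := by
  obtain ⟨K, hK⟩ := hL.exists_bound
  obtain ⟨K', hK'⟩ := hL'.exists_bound
  refine ⟨ℓ ^ 4 * (K * K'), fun x y => ?_⟩
  rw [mul_assoc]
  refine mul_le_mul_of_nonneg_left ?_ (by positivity)
  calc L x * L' y ≤ |L x * L' y| := le_abs_self _
    _ = |L x| * |L' y| := abs_mul _ _
    _ ≤ K * K' := mul_le_mul (hK x) (hK' y) (abs_nonneg _) K.2

theorem exists_large (δ M : ℝ) (hδ : 0 < δ) :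
    ∃ N > 0, ∀ x : ℝ, N ≤ x → |1 / x ^ 2| < δ ∧ M < x ^ 4 := by
  have h1 : Tendsto (fun x : ℝ => |1 / x ^ 2|) atTop (𝓝 0) := by
    simpa using ((tendsto_const_nhds (x := (1 : ℝ))).div_atTop
      (tendsto_pow_atTop (two_ne_zero))).abs
  have h2 : Tendsto (fun x : ℝ => x ^ 4) atTop atTop := tendsto_pow_atTop four_ne_zero
  obtain ⟨N, hN⟩ := eventually_atTop.1
    ((h1.eventually_lt_const hδ).and (h2.eventually_gt_atTop M))
  exact ⟨max N 1, by positivity, fun x hx => hN x ((le_max_left _ _).trans hx)⟩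

theorem tendsto_one_div_sq (a b : ℝ) :
    Tendsto (fun r : ℝ => ((1 / r ^ 2, a, b) : Coord)) atTop (𝓝 (0, a, b)) :=
  (tendsto_const_nhds.div_atTop (tendsto_pow_atTop two_ne_zero)).prodMk_nhds tendsto_const_nhds

/-- `Φ` is read off from the solved matching equations, so it intertwines the two embeddings. The
gauge conditions and the invertible derivative then follow from the Bañados form of the pulled-back
metric; injectivity and the size of the image use the exchanged system. -/
theorem exists_isFGDiffeo {ℓ : ℝ} (hℓ : 0 < ℓ) {Lp Lm hp hm : ℝ → ℝ}
    (hLp : IsBanadosFunction Lp) (hLm : IsBanadosFunction Lm)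
    (hhp : IsBoundaryMap hp) (hhm : IsBoundaryMap hm) :
    ∃ ρ : ℝ, 0 ≤ ρ ∧ ∃ Φ : Coord → Coord, IsFGDiffeo ℓ Lp Lm hp hm ρ Φ ∧
      ∃ ρ' : ℝ, nearBoundary ρ' ⊆ Φ '' nearBoundary ρ := by
  obtain ⟨cp, sp, hP⟩ := hLp.exists_isHillBasis
  obtain ⟨cm, sm, hM⟩ := hLm.exists_isHillBasis
  obtain ⟨kp, kpc, hkp, hkp', kps⟩ := hhp.exists_inverse
  obtain ⟨km, kmc, hkm, hkm', kms⟩ := hhm.exists_inverse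
  have mp := hP.isMatching hLp.periodic hhp
  have mm := hM.isMatching hLm.periodic hhm
  have mp' := mp.symm kpc hkp' kps
  have mm' := mm.symm kmc hkm' kms
  have hP' := mp.right
  have hM' := mm.right
  set dp := hillTransform cp hp with hdp
  set ep := hillTransform sp hp with hep
  set dm := hillTransform cm hm with hdm
  set em := hillTransform sm hm with hem
  obtain ⟨δ, hδ, κ, hκ, q₀, hq₀, S, hS, huniq, hsmall, hshift⟩ := exists_matching_solution ℓ mp mm
  obtain ⟨δ', hδ', κ', hκ', q₀', hq₀', S', hS', huniq', hsmall', -⟩ :=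
    exists_matching_solution ℓ mp' mm'
  -- The constants `κ₁` and `κ₂` make a solution of either system close enough to the other graph
  -- for the uniqueness of the other system to apply.
  obtain ⟨κ₁, hκ₁, hd₁⟩ := exists_dist_inverse_lt mp mm mp' mm' hkp hkm hκ'
  obtain ⟨κ₂, hκ₂, hd₂⟩ := exists_dist_inverse_lt mp' mm' mp mm hkp' hkm' hκ
  obtain ⟨δ₁, hδ₁, hs₁⟩ := hsmall κ₁ hκ₁
  obtain ⟨δ₂, hδ₂, hs₂⟩ := hsmall' κ₂ hκ₂
  obtain ⟨M, hMb⟩ := exists_bound_mul hLp hLm ℓ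
  obtain ⟨M', hMb'⟩ := exists_bound_mul (hhp.isBanadosFunction_transformedL hLp)
    (hhm.isBanadosFunction_transformedL hLm) ℓ
  obtain ⟨N, hN, hlarge⟩ := exists_large (min (min δ δ') (min δ₁ δ₂)) (max M M')
    (lt_min (lt_min hδ hδ') (lt_min hδ₁ hδ₂))
  have small : ∀ {x : ℝ}, N ≤ x → |1 / x ^ 2| < δ ∧ |1 / x ^ 2| < δ' ∧ |1 / x ^ 2| < δ₁ ∧
      |1 / x ^ 2| < δ₂ ∧ M < x ^ 4 ∧ M' < x ^ 4 := fun {x} hx => by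
    obtain ⟨h1, h2⟩ := hlarge x hx
    rw [lt_min_iff, lt_min_iff, lt_min_iff] at h1
    rw [max_lt_iff] at h2
    exact ⟨h1.1.1, h1.1.2, h1.2.1, h1.2.2, h2.1, h2.2⟩
  -- The second entry forces `R = r Q ≥ N`, so that image points lie in the patch and in the range
  -- where the exchanged system is uniquely solvable.
  set ρ := max N (N / q₀) with hρdef
  have hρ0 : 0 < ρ := lt_max_of_lt_left hN
  have hNr : ∀ {r : ℝ}, ρ < r → N ≤ r := fun h => (le_max_left _ _).trans h.le
  have hNq : ∀ {r : ℝ}, ρ < r → N ≤ r * q₀ := fun h =>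
    (div_le_iff₀ hq₀).1 ((le_max_right _ _).trans h.le)
  -- the radial inversion and the diffeomorphism
  let T : Coord → Coord := fun p => (1 / p.1 ^ 2, p.2)
  let Q : Coord → ℝ := fun p => matchingRatio ℓ cp sp dp ep cm sm dm em (T p, S (T p))
  let Φ : Coord → Coord := fun p => (p.1 * Q p, S (T p))
  have hpos : ∀ {p : Coord}, p ∈ nearBoundary ρ → 0 < p.1 := fun h => hρ0.trans h
  have hQ : ∀ {p : Coord}, p ∈ nearBoundary ρ → q₀ < Q p := fun {p} h =>
    (hS (T p) (small (hNr h)).1).2.2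
  have hR : ∀ {p : Coord}, p ∈ nearBoundary ρ → N ≤ (Φ p).1 := fun {p} h =>
    (hNq h).trans (mul_le_mul_of_nonneg_left (hQ h).le (hpos h).le)
  have hR0 : ∀ {p : Coord}, p ∈ nearBoundary ρ → 0 < (Φ p).1 := fun h => hN.trans_le (hR h)
  have hemb : ∀ {p : Coord}, p ∈ nearBoundary ρ →
      hillEmbedding ℓ cp sp cm sm (Φ p) = hillEmbedding ℓ dp ep dm em p := fun {p} h => by
    have h0 := (hS (T p) (small (hNr h)).1).1
    exact (hillEmbedding_eq_iff hP hP' hM hM' (hR0 h).ne' (hpos h).ne').2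
      ⟨congrArg Prod.fst h0, congrArg Prod.snd h0, rfl⟩
  have hsm : ∀ {p : Coord}, p ∈ nearBoundary ρ → ContDiffAt ℝ ∞ Φ p := fun {p} h => by
    have hsq : ContDiffAt ℝ ∞ (fun p : Coord => p.1 ^ 2) p := by fun_prop
    have hT : ContDiffAt ℝ ∞ T p :=
      (contDiffAt_const.div hsq (pow_ne_zero 2 (hpos h).ne')).prodMk contDiffAt_snd
    have hST : ContDiffAt ℝ ∞ (fun p => S (T p)) p :=
      (hS (T p) (small (hNr h)).1).2.1.comp p hT
    exact (contDiffAt_fst.mul ((contDiff_matching mp mm).2.contDiffAt.comp p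
      (hT.prodMk hST))).prodMk hST
  have hpull : ∀ {p : Coord}, p ∈ nearBoundary ρ → ∀ v w,
      pullbackTensor Φ (banadosMetric ℓ Lp Lm) p v w =
        banadosMetric ℓ (transformedL Lp hp) (transformedL Lm hm) p v w := fun {p} h =>
    pullbackTensor_eq_of_eventuallyEq hP hM hP' hM' ((hsm h).differentiableAt (by simp))
      (hR0 h).ne' (hpos h).ne' (by
        filter_upwards [(isOpen_nearBoundary ρ).mem_nhds h] with q hq using hemb hq)
  have hSt : ∀ a b : ℝ, Tendsto (fun r : ℝ => S (T (r, a, b))) atTop (𝓝 (hp a, hm b)) := by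
    intro a b
    rw [Metric.tendsto_nhds]
    intro ε hε
    obtain ⟨δ₃, hδ₃, h₃⟩ := hsmall ε hε
    obtain ⟨N₃, -, hN₃⟩ := exists_large δ₃ 0 hδ₃
    filter_upwards [eventually_ge_atTop N₃] with r hr
    exact h₃ (T (r, a, b)) (hN₃ r hr).1
  have hFG : IsFGDiffeo ℓ Lp Lm hp hm ρ Φ :=
    { smooth := fun p h => (hsm h).contDiffWithinAt
      -- Two preimages of one point solve the exchanged system with the same data, so their boundary
      -- coordinates agree; the ratio formula then fixes the radius.
      injOn := by
        intro p h p' h' he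
        have e0 := hemb h
        have e1 := hemb h'
        rw [← he] at e1
        have i0 := (hillEmbedding_eq_iff hP' hP hM' hM (hpos h).ne' (hR0 h).ne').1 e0.symm
        have i1 := (hillEmbedding_eq_iff hP' hP hM' hM (hpos h').ne' (hR0 h).ne').1 e1.symm
        set z : Coord := (1 / (Φ p).1 ^ 2, (Φ p).2) with hz
        have hzδ : |z.1| < δ' := (small (hR h)).2.1
        have c0 : dist p.2 (boundaryPair kp km z) < κ' :=
          hd₁ (T p) z (hs₁ (T p) (small (hNr h)).2.2.1)
        have c1 : dist p'.2 (boundaryPair kp km z) < κ' := by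
          refine hd₁ (T p') z ?_
          have : z.2 = S (T p') := congrArg Prod.snd he
          rw [this]
          exact hs₁ (T p') (small (hNr h')).2.2.1
        have u0 : p.2 = S' z := huniq' z p.2 hzδ c0 (Prod.ext i0.1 i0.2.1)
        have u1 : p'.2 = S' z := huniq' z p'.2 hzδ c1 (Prod.ext i1.1 i1.2.1)
        have u : p.2 = p'.2 := u0.trans u1.symm
        refine Prod.ext ?_ u
        have ua : p.2.1 = p'.2.1 := congrArg Prod.fst u
        have ub : p.2.2 = p'.2.2 := congrArg Prod.snd u
        rw [i0.2.2, i1.2.2, ua, ub]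
      -- A vector killed by the derivative would lie in the kernel of the pulled-back Bañados
      -- metric, which is nondegenerate for `r⁴ > M'`.
      bijective_fderiv := by
        intro p h
        obtain ⟨e, he⟩ := exists_equiv_of_injective (fderiv ℝ Φ p) (fun v hv => by
          refine eq_zero_of_banadosMetric hℓ.ne' (hpos h).ne'
            ((hMb' p.2.1 p.2.2).trans_lt (small (hNr h)).2.2.2.2.2).ne fun w => ?_
          rw [← hpull h v w, pullbackTensor, hv]
          simp [banadosMetric])
        rw [← he]
        exact e.bijective
      mapsTo := fun p h => ⟨hR0 h, (hMb _ _).trans_lt (small (hR h)).2.2.2.2.1⟩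
      deck_comm := by
        intro p h
        have hT : T (deck p) = T p + latticeShift 1 (-1) := by
          rw [deck_eq_add_latticeShift]
          ext <;> simp [T, latticeShift]
        have h1 : (deck p).1 = p.1 := rfl
        have hST : S (T (deck p)) = S (T p) + (latticeShift 1 (-1)).2 := by
          rw [hT]; exact hshift 1 (-1) (T p) (small (hNr h)).1
        have hQd : Q (deck p) = Q p := by
          simp only [Q]
          rw [hST, hT, matchingRatio_shift mp mm]
        rw [deck_eq_add_latticeShift (Φ p)]
        refine Prod.ext ?_ hST
        change (deck p).1 * Q (deck p) = p.1 * Q p + 0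
        rw [hQd, h1, add_zero]
      gauge := by
        intro p h
        rw [hpull h, hpull h, hpull h]
        exact isFeffermanGrahamOn_banadosMetric ℓ _ _ _ p h
      tendsto_plus := fun a b => (continuous_fst.tendsto _).comp (hSt a b)
      tendsto_minus := fun a b => (continuous_snd.tendsto _).comp (hSt a b)
      tendsto_radial := by
        intro a b
        have h1 : Tendsto (fun r : ℝ => Q (r, a, b)) atTop
            (𝓝 (matchingRatio ℓ cp sp dp ep cm sm dm em ((0, a, b), (hp a, hm b)))) :=
          ((contDiff_matching mp mm).2.continuous.tendsto _).comp
            ((tendsto_one_div_sq a b).prodMk_nhds (hSt a b))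
        have h2 : matchingRatio ℓ cp sp dp ep cm sm dm em ((0, a, b), (hp a, hm b)) =
            1 / √(deriv hp a * deriv hm b) := by
          rw [one_div_sqrt_mul_deriv hhp hhm, matchingRatio, radialRatio]
          simp only [(hP.wedge_values hhp a).2.1, (hM.wedge_values hhm b).2.1, hdp, hep, hdm, hem]
          ring
        rw [h2] at h1
        refine h1.congr' ?_
        filter_upwards [eventually_gt_atTop 0] with r hr
        exact (mul_div_cancel_left₀ _ hr.ne').symm }
  -- The candidate preimage `p` solves the exchanged system at `z` and has radius greater than `z.1
  -- * q₀'`, which exceeds `ρ` by this choice. Uniqueness for the original system then gives `Φ p =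
  -- z`.
  refine ⟨ρ, hρ0.le, Φ, hFG, max N (ρ / q₀'), fun z hz => ?_⟩
  have hzN : N ≤ z.1 := (le_max_left _ _).trans (le_of_lt hz)
  have hz0 : 0 < z.1 := hN.trans_le hzN
  have hzq : ρ < z.1 * q₀' := (div_lt_iff₀ hq₀').1 ((le_max_right _ _).trans_lt hz)
  obtain ⟨z1, z2, -, z4, -, -⟩ := small hzN
  obtain ⟨hS1, -, hS3⟩ := hS' (T z) z2
  set p : Coord := (z.1 * matchingRatio ℓ dp ep cp sp dm em cm sm (T z, S' (T z)), S' (T z)) with hp'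
  have hpρ : p ∈ nearBoundary ρ := hzq.trans (mul_lt_mul_of_pos_left hS3 hz0)
  have he : hillEmbedding ℓ dp ep dm em p = hillEmbedding ℓ cp sp cm sm z :=
    (hillEmbedding_eq_iff hP' hP hM' hM (hpos hpρ).ne' hz0.ne').2
      ⟨congrArg Prod.fst hS1, congrArg Prod.snd hS1, rfl⟩
  obtain ⟨i1, i2, i3⟩ := (hillEmbedding_eq_iff hP hP' hM hM' hz0.ne' (hpos hpρ).ne').1 he.symm
  have hz2 : z.2 = S (T p) := huniq (T p) z.2 (small (hNr hpρ)).1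
    (hd₂ (T z) (T p) (hs₂ (T z) z4)) (Prod.ext i1 i2)
  refine ⟨p, hpρ, Prod.ext ?_ hz2.symm⟩
  rw [i3]
  change p.1 * Q p = _
  simp only [Q]
  rw [← hz2]
  rfl

/-! ### The main theorem -/

theorem mainTheorem11 (ℓ : ℝ) (hℓ : 0 < ℓ) (Lp Lm hp hm : ℝ → ℝ)
    (hLp : IsBanadosFunction Lp) (hLm : IsBanadosFunction Lm)
    (hhp : IsBoundaryMap hp) (hhm : IsBoundaryMap hm) :
    -- diffeomorphisms with the given boundary maps exist, onto a neighbourhood of the boundary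
    (∃ ρ : ℝ, 0 ≤ ρ ∧ ∃ Φ : Coord → Coord, IsFGDiffeo ℓ Lp Lm hp hm ρ Φ ∧
      ∃ ρ' : ℝ, nearBoundary ρ' ⊆ Φ '' nearBoundary ρ) ∧
    -- every such diffeomorphism has the following expansion and maps the Bañados metric with
    -- functions `L_±` to the Bañados metric with the transformed functions
    (∀ ρ : ℝ, 0 ≤ ρ → ∀ Φ : Coord → Coord, IsFGDiffeo ℓ Lp Lm hp hm ρ Φ →
      (∀ a b : ℝ,
        ((fun r : ℝ => (Φ (r, a, b)).2.1 -
            (hp a + ℓ ^ 2 / (2 * r ^ 2) * (iteratedDeriv 2 hm b / deriv hm b) * deriv hp a))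
          =O[atTop] fun r : ℝ => 1 / r ^ 4) ∧
        ((fun r : ℝ => (Φ (r, a, b)).2.2 -
            (hm b + ℓ ^ 2 / (2 * r ^ 2) * (iteratedDeriv 2 hp a / deriv hp a) * deriv hm b))
          =O[atTop] fun r : ℝ => 1 / r ^ 4) ∧
        ((fun r : ℝ => (Φ (r, a, b)).1 - r / √(deriv hp a * deriv hm b))
          =O[atTop] fun r : ℝ => 1 / r)) ∧
      (∀ p ∈ nearBoundary ρ, ∀ v w : Coord,
        pullbackTensor Φ (banadosMetric ℓ Lp Lm) p v w =
          banadosMetric ℓ (transformedL Lp hp) (transformedL Lm hm) p v w)) ∧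
    -- the transformed functions are again admissible
    IsBanadosFunction (transformedL Lp hp) ∧ IsBanadosFunction (transformedL Lm hm) ∧
    -- Liouville form, `h' = exp Ψ`
    (∀ Ψ : ℝ → ℝ, (∀ x, deriv hp x = Real.exp (Ψ x)) →
      ContDiff ℝ ∞ Ψ ∧ Function.Periodic Ψ (2 * Real.pi) ∧
      ∀ x, transformedL Lp hp x = Real.exp (2 * Ψ x) * Lp (hp x) +
        1 / 4 * deriv Ψ x ^ 2 - 1 / 2 * iteratedDeriv 2 Ψ x) ∧
    (∀ Ψ : ℝ → ℝ, (∀ x, deriv hm x = Real.exp (Ψ x)) →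
      ContDiff ℝ ∞ Ψ ∧ Function.Periodic Ψ (2 * Real.pi) ∧
      ∀ x, transformedL Lm hm x = Real.exp (2 * Ψ x) * Lm (hm x) +
        1 / 4 * deriv Ψ x ^ 2 - 1 / 2 * iteratedDeriv 2 Ψ x) := by
  obtain ⟨cp, sp, hP⟩ := hLp.exists_isHillBasis
  obtain ⟨cm, sm, hM⟩ := hLm.exists_isHillBasis
  refine ⟨exists_isFGDiffeo hℓ hLp hLm hhp hhm, fun ρ hρ Φ hΦ =>
    ⟨fun a b => hΦ.expansion hℓ hρ hhp hhm hP hM a b,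
      fun p hp' v w => hΦ.pullbackTensor_eq hℓ hρ hhp hhm hP hM hp' v w⟩,
    hhp.isBanadosFunction_transformedL hLp, hhm.isBanadosFunction_transformedL hLm,
    fun Ψ hΨ => hhp.liouville_form Lp hΨ, fun Ψ hΨ => hhm.liouville_form Lm hΨ⟩
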